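/- Let $Y\subset\mathbb R^3$ be a nonempty finite set with $n$ points; index the coordinates of $\mathbb R^n$ by $Y$, and work in the real Hilbert space $L^2(\mathbb R^3)$. All derivatives are distributional. **Notation.** For $\lambda>0$ let $$G_\lambda:\mathbb R^n\to L^2(\mathbb R^3),\qquad (G_\lambda\xi)(x)=\sum_{y\in Y}\frac{e^{-\sqrt\lambda|x-y|}}{4\pi|x-y|}\,\xi_y ,$$ with adjoint $G_\lambda^*$, and let $(G_0\xi)(x)=\frac1{4\pi}\sum_{y\in Y}\frac{\xi_y}{|x-y|}$. For $\lambda\ge 0$ let $M_\lambda:\mathbb R^n\to\mathbb R^n$ be represented by the matrix $$(M_\lambda)_{yy'}=\frac1{4\pi}\begin{cases}\sqrt\lambda & y=y'\\ -\dfrac{e^{-\sqrt\lambda|y-y'|}}{|y-y'|} & y\ne y'.\end{cases}$$ Let $-\Delta$ without index denote the linear operator in $L^2(\mathbb R^3)$ with domain $H^2(\mathbb R^3)$, and let $$\tilde H^2(\mathbb R^3)=\{u\in C_b(\mathbb R^3):\ |\nabla u|\in L^2(\mathbb R^3),\ \Delta u\in L^2(\mathbb R^3)\}.$$ For $u=u_0+G_0\xi$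 with $u_0\in\tilde H^2(\mathbb R^3)$ let $\tilde\tau u\in\mathbb R^n$ be given by $(\tilde\tau u)_y=\lim_{x\to y}\bigl(u(x)-\frac{1}{4\pi}\frac{\xi_y}{|x-y|}\bigr)$, $y\in Y$. A relation $\Theta\subset\mathbb R^n\times\mathbb R^n$ is monotone of type $\omega$ if $\langle\tilde\xi-\tilde\zeta,\xi-\zeta\rangle\ge-\omega|\xi-\zeta|^2$ for all $(\xi,\tilde\xi),(\zeta,\tilde\zeta)\in\Theta$, and maximal monotone of type $\omega$ if moreover it is not properly contained in another relation that is monotone of type $\omega$. A single-valued nonlinear operator $A:\mathscr D(A)\subseteq H\to H$ in a real Hilbert space $H$ is maximal monotone if $\langle A(u)-A(v),u-v\rangle\ge0$ for all $u,v\in\mathscr D(A)$ and $\operatorname{range}(A+\lambda)=H$ for every $\lambda>0$. **Proposition.** Let $\Theta\subset\mathbb R^n\times\mathbb R^n$ be a maximal monotone relation of type $\gamma_0$, where $\gamma_0$ is the smallest eigenvalue of $M_0$. Then $$\mathscr D((-\Delta)_\Theta)=\{u\in L^2(\mathbb R^3):\ u=u_0+G_0\xi_u,\ u_0\in\tilde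 H^2(\mathbb R^3),\ (\xi_u,\tilde\tau u)\in\Theta\},\qquad (-\Delta)_\Theta u:=-\Delta u_0,$$ is a well-defined single-valued operator, it is maximal monotone, and for every $\lambda>0$ the operators $(-\Delta)_\Theta+\lambda:\mathscr D((-\Delta)_\Theta)\to L^2(\mathbb R^3)$ and $-\Delta+\lambda:H^2(\mathbb R^3)\to L^2(\mathbb R^3)$ are bijective, the inverse relation of $\Theta+M_\lambda=\{(\xi,\tilde\xi+M_\lambda\xi):(\xi,\tilde\xi)\in\Theta\}$ is the graph of a single-valued map $(\Theta+M_\lambda)^{-1}:\mathbb R^n\to\mathbb R^n$, and $$((-\Delta)_\Theta+\lambda)^{-1}=(-\Delta+\lambda)^{-1}+G_\lambda(\Theta+M_\lambda)^{-1}\circ G_\lambda^* .$$ -/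

import Mathlib

open MeasureTheory Filter Topology

namespace NLPoint

/-! ### Monotone operators and relations in a real Hilbert space -/

section Monotone

variable {H : Type*} [NormedAddCommGroup H] [InnerProductSpace ℝ H]

/-- A nonlinear operator `A` with domain `D ⊆ H` is monotone of type `ω`:
`⟪(A + ω) u - (A + ω) v, u - v⟫ ≥ 0` for all `u, v` in the domain. -/
def IsMonotoneOp (ω : ℝ) {D : Set H} (A : D → H) : Prop :=
  ∀ u v : D, 0 ≤ inner ℝ ((A u + ω • (u : H)) - (A v + ω • (v : H))) ((u : H) - (v : H))

/-- A nonlinear operator is maximal monotone of type `ω` if it is monotone of type `ω` and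
`range (A + lam) = H` for every `lam > ω`. -/
def IsMaximalMonotoneOp (ω : ℝ) {D : Set H} (A : D → H) : Prop :=
  IsMonotoneOp ω A ∧ ∀ lam : ℝ, ω < lam → Set.range (fun u : D => A u + lam • (u : H)) = Set.univ

/-- A relation `Θ ⊆ H × H` is monotone of type `ω`. -/
def IsMonotoneRel (ω : ℝ) (Θ : Set (H × H)) : Prop :=
  ∀ p ∈ Θ, ∀ q ∈ Θ, -ω * ‖p.1 - q.1‖ ^ 2 ≤ inner ℝ (p.2 - q.2) (p.1 - q.1)

/-- A relation is maximal monotone of type `ω` if it is monotone of type `ω` and is not properly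
contained in another relation that is monotone of type `ω`. -/
def IsMaximalMonotoneRel (ω : ℝ) (Θ : Set (H × H)) : Prop :=
  IsMonotoneRel ω Θ ∧ ∀ Θ' : Set (H × H), IsMonotoneRel ω Θ' → Θ ⊆ Θ' → Θ' = Θ

/-- The sum of a relation and (the graph of) a single-valued map. -/
def relAdd (Θ : Set (H × H)) (B : H → H) : Set (H × H) :=
  {p | (p.1, p.2 - B p.1) ∈ Θ}

/-- `V = Θ⁻¹` for a relation `Θ`: the inverse relation of `Θ` is the graph of the everywhere
defined single-valued map `V`. -/
def IsInverseMap (Θ : Set (H × H)) (V : H → H) : Prop :=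
  ∀ ξ η : H, V η = ξ ↔ (ξ, η) ∈ Θ

/-- `R = (A + lam)⁻¹`: the map `A + lam : D → H` is a bijection, with inverse `R : H → D ⊆ H`. -/
def IsResolvent {D : Set H} (A : D → H) (lam : ℝ) (R : H → H) : Prop :=
  (∀ u : D, R (A u + lam • (u : H)) = u) ∧ ∀ f : H, ∃ u : D, (u : H) = R f ∧ A u + lam • (u : H) = f

end Monotone

/-! ### Function spaces on `ℝ³` and the Laplacian -/

/-- Euclidean three-space. -/
abbrev E3 : Type := EuclideanSpace ℝ (Fin 3)

/-- The real Hilbert space `L²(ℝ³)`. -/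
abbrev L2 : Type := Lp ℝ 2 (volume : Measure E3)

/-- The standard unit vectors. -/
noncomputable def unitVec (i : Fin 3) : E3 := EuclideanSpace.single i 1

/-- Test functions: `φ ∈ C_c^∞(ℝ³)`. -/
def IsTest (φ : E3 → ℝ) : Prop :=
  ContDiff ℝ (⊤ : ℕ∞) φ ∧ HasCompactSupport φ

/-- `g = ∂ᵢ u` in the sense of distributions. -/
def HasWeakPartial (i : Fin 3) (u g : E3 → ℝ) : Prop :=
  ∀ φ : E3 → ℝ, IsTest φ →
    ∫ x, u x * fderiv ℝ φ x (unitVec i) = -∫ x, g x * φ x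

/-- `g = ∂ᵢ ∂ⱼ u` in the sense of distributions. -/
def HasWeakSecondPartial (i j : Fin 3) (u g : E3 → ℝ) : Prop :=
  ∀ φ : E3 → ℝ, IsTest φ →
    ∫ x, u x * iteratedFDeriv ℝ 2 φ x ![unitVec i, unitVec j] = ∫ x, g x * φ x

/-- `g = Δ u` in the sense of distributions. -/
def HasWeakLaplacian (u g : E3 → ℝ) : Prop :=
  ∀ φ : E3 → ℝ, IsTest φ →
    ∫ x, u x * Laplacian.laplacian φ x = ∫ x, g x * φ x

/-- The Sobolev space `H²(ℝ³)`: square integrable functions with square integrable second order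
distributional partial derivatives. -/
def H2 : Set L2 :=
  {u | ∀ i j : Fin 3, ∃ g : L2, HasWeakSecondPartial i j u g}

/-- The linear operator `-Δ : H²(ℝ³) → L²(ℝ³)`, `-Δ u = -∑ᵢ ∂ᵢ∂ᵢ u`. -/
noncomputable def freeLaplacian (u : H2) : L2 :=
  -∑ i : Fin 3, Classical.choose (u.2 i i)

/-- The space `H̃²(ℝ³)` of continuous bounded functions whose distributional gradient and
distributional Laplacian are square integrable. -/
def Htilde2 : Set (E3 → ℝ) :=
  {u | Continuous u ∧ (∃ C : ℝ, ∀ x, |u x| ≤ C) ∧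
    (∀ i : Fin 3, ∃ g : L2, HasWeakPartial i u g) ∧ ∃ f : L2, HasWeakLaplacian u f}

/-! ### The Green functions -/

/-- The integral kernel `e^{-√lam |x - y|} / (4π |x - y|)` of `(-Δ + lam)⁻¹`. -/
noncomputable def greenFun (lam : ℝ) (y x : E3) : ℝ :=
  Real.exp (-√lam * ‖x - y‖) / (4 * Real.pi * ‖x - y‖)

lemma memLp_greenFun {lam : ℝ} (hlam : 0 < lam) (y : E3) :
    MemLp (greenFun lam y) 2 (volume : Measure E3) := by
  have hs : 0 < √lam := Real.sqrt_pos.mpr hlam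
  have h0 : MemLp (greenFun lam 0) 2 (volume : Measure E3) := by
    have hm : AEStronglyMeasurable (greenFun lam 0) (volume : Measure E3) := by
      unfold greenFun
      exact Measurable.aestronglyMeasurable (by fun_prop)
    rw [memLp_two_iff_integrable_sq hm]
    have := (integrable_fun_norm_addHaar (volume : Measure E3)
      (f := fun r : ℝ => (Real.exp (-√lam * r) / (4 * Real.pi * r)) ^ 2)).2 ?_
    · refine this.congr (Eventually.of_forall fun x => ?_)
      simp [greenFun]
    · have h1 : IntegrableOn (fun r : ℝ => (4 * Real.pi)⁻¹ ^ 2 * Real.exp (-(2 * √lam) * r))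
          (Set.Ioi 0) :=
        (integrableOn_exp_mul_Ioi (by linarith) 0).const_mul _
      refine h1.congr_fun (fun r hr => ?_) measurableSet_Ioi
      have hr' : r ≠ 0 := ne_of_gt hr
      have hp : Real.pi ≠ 0 := Real.pi_ne_zero
      have he : Real.exp (-(2 * √lam) * r) = Real.exp (-√lam * r) ^ 2 := by
        rw [← Real.exp_nat_mul]; congr 1; push_cast; ring
      simp only [finrank_euclideanSpace, Fintype.card_fin, smul_eq_mul, he]
      field_simp
  have := h0.comp_measurePreserving (measurePreserving_sub_right (volume : Measure E3) y)
  refine this.ae_eq (Eventually.of_forall fun x => ?_)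
  simp [greenFun]

/-- The coordinate space `ℝⁿ` for a finite set `Y` of `n` points, with coordinates indexed by
the points of `Y`. -/
abbrev Coord (Y : Finset E3) : Type := EuclideanSpace ℝ Y

/-- The bounded linear operator `G_lam : ℝⁿ → L²(ℝ³)` for `lam > 0`,
`(G_lam ξ)(x) = ∑_{y ∈ Y} e^{-√lam |x - y|} / (4π |x - y|) ξ_y`. -/
noncomputable def G (Y : Finset E3) {lam : ℝ} (hlam : 0 < lam) : Coord Y →L[ℝ] L2 :=
  ∑ y : Y, (EuclideanSpace.proj y : Coord Y →L[ℝ] ℝ).smulRight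
    ((memLp_greenFun hlam (y : E3)).toLp (greenFun lam y))

/-- `(G₀ ξ)(x) = (1 / 4π) ∑_{y ∈ Y} ξ_y / |x - y|`. -/
noncomputable def G0 (Y : Finset E3) (ξ : Coord Y) (x : E3) : ℝ :=
  1 / (4 * Real.pi) * ∑ y : Y, ξ y / ‖x - (y : E3)‖

/-- The matrix `M_lam`, `lam ≥ 0`. -/
noncomputable def M (Y : Finset E3) (lam : ℝ) : Matrix Y Y ℝ := fun y y' =>
  1 / (4 * Real.pi) *
    (open Classical in
      if y = y' then √lam
      else -(Real.exp (-√lam * ‖(y : E3) - (y' : E3)‖) / ‖(y : E3) - (y' : E3)‖))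

/-- The linear operator on `ℝⁿ` represented by the matrix `M_lam`. -/
noncomputable def MOp (Y : Finset E3) (lam : ℝ) : Coord Y →ₗ[ℝ] Coord Y :=
  open Classical in Matrix.toEuclideanLin (M Y lam)

/-! ### The nonlinear point perturbation of the Laplacian -/

/-- `u = u₀ + G₀ ξ` (as elements of `L²(ℝ³)`, that is, almost everywhere) with `u₀ ∈ H̃²(ℝ³)`. -/
def IsDecomp (Y : Finset E3) (u : L2) (u₀ : E3 → ℝ) (ξ : Coord Y) : Prop :=
  u₀ ∈ Htilde2 ∧ (u : E3 → ℝ) =ᵐ[volume] fun x => u₀ x + G0 Y ξ x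

/-- `η = τ̃ u` for `u = u₀ + G₀ ξ`, that is,
`η_y = lim_{x → y} (u(x) - ξ_y / (4π |x - y|))` for every `y ∈ Y`. -/
def HasTrace (Y : Finset E3) (u₀ : E3 → ℝ) (ξ η : Coord Y) : Prop :=
  ∀ y : Y, Tendsto (fun x : E3 => u₀ x + G0 Y ξ x - 1 / (4 * Real.pi) * (ξ y / ‖x - (y : E3)‖))
    (𝓝[≠] (y : E3)) (𝓝 (η y))

/-- The domain of `(-Δ)_Θ`: all `u = u₀ + G₀ ξ ∈ L²(ℝ³)` with `u₀ ∈ H̃²(ℝ³)` and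
`(ξ, τ̃ u) ∈ Θ`. -/
def pointDomain (Y : Finset E3) (Θ : Set (Coord Y × Coord Y)) : Set L2 :=
  {u | ∃ (u₀ : E3 → ℝ) (ξ η : Coord Y), IsDecomp Y u u₀ ξ ∧ HasTrace Y u₀ ξ η ∧ (ξ, η) ∈ Θ}

lemma exists_laplacian_of_mem {Y : Finset E3} {Θ : Set (Coord Y × Coord Y)}
    (u : pointDomain Y Θ) :
    ∃ f : L2, ∃ (u₀ : E3 → ℝ) (ξ : Coord Y), IsDecomp Y u u₀ ξ ∧ HasWeakLaplacian u₀ f := by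
  obtain ⟨u₀, ξ, η, h, -, -⟩ := u.2
  obtain ⟨f, hf⟩ := h.1.2.2.2
  exact ⟨f, u₀, ξ, h, hf⟩

/-- The operator `(-Δ)_Θ u = -Δ u₀` for `u = u₀ + G₀ ξ`. -/
noncomputable def pointLaplacian (Y : Finset E3) (Θ : Set (Coord Y × Coord Y))
    (u : pointDomain Y Θ) : L2 :=
  -Classical.choose (exists_laplacian_of_mem u)

end NLPoint

/-!
The Yukawa kernel `greenFun lam y` is a fundamental solution of `-Δ + lam`
(`integral_greenFun_mul_laplacian`), and `greenFun lam y - greenFun 0 y` extends to an element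
`regKernel lam y` of `H̃²(ℝ³)` with value `-√lam / 4π` at `y`. Hence, for `f ∈ L²(ℝ³)` and `ξ ∈ ℝⁿ`,
the function `u = (-Δ + lam)⁻¹ f + G_lam ξ` is of the form `u₀ + G₀ ξ` with `u₀ ∈ H̃²(ℝ³)`, and it
satisfies `-Δ u₀ + lam u = f` and `τ̃ u = G_lam^* f - M_lam ξ` (`exists_decomp`). Conversely, every `u`
with such a decomposition is of this form (`IsDecomp.eq_freeResolvent_add`), because `-Δ + lam` is
injective on `L²(ℝ³)` and `(u₀, ξ)` is determined by `u`. So `((-Δ)_Θ + lam) u = f` is equivalent to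
`u = (-Δ + lam)⁻¹ f + G_lam ξ` with `(ξ, G_lam^* f) ∈ Θ + M_lam`, and everything reduces to the
solvability of this finite-dimensional inclusion.

Applying the equivalence to `u = G_mu ξ` gives `M_lam - M_mu = (lam - mu) G_lam^* G_mu`, so that
`lam ↦ ⟪M_lam ξ, ξ⟫` is strictly increasing and `M_lam > M_0 ≥ γ₀` for `lam > 0`
(`inner_MOp_zero_lt`). Therefore `Θ + M_lam` is strongly monotone, and Minty's theorem
(`IsMaximalMonotoneRel.exists_mem_sub`) shows that its inverse is a single-valued map defined
everywhere. Monotonicity of `(-Δ)_Θ + lam` is read off from the resolvent formula, as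
`(-Δ + lam)⁻¹` and `Θ + M_lam` are monotone, and `lam → 0` gives the monotonicity of `(-Δ)_Θ`
(`isMonotoneOp_pointLaplacian`).

The resolvent `(-Δ + lam)⁻¹` is constructed by a Fourier multiplier on Schwartz functions and then by
density, using `L²` bounds obtained from integration by parts (`exists_freeResolvent`). The formula
`((-Δ + lam)⁻¹ f)(y) = ⟪greenFun lam y, f⟫` provides the bounded continuous representative and
replaces the Sobolev embedding.
-/

namespace NLPoint

/-! ### Minty's theorem for relations in finite dimension -/

section Minty

variable {F : Type*} [NormedAddCommGroup F] [InnerProductSpace ℝ F]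

lemma convexOn_inner_add_sub {B : F →ₗ[ℝ] F} (hB : ∀ x, 0 ≤ inner ℝ (B x) x) (c ζ : F) :
    ConvexOn ℝ Set.univ fun ξ => inner ℝ (B ξ + c) (ξ - ζ) := by
  refine ⟨convex_univ, fun x _ y _ s t hs ht hst => ?_⟩
  have h := mul_nonneg (mul_nonneg hs ht) (hB (x - y))
  obtain rfl : t = 1 - s := by linarith
  simp only [map_add, map_sub, map_smul, inner_add_left, inner_sub_left, inner_sub_right,
    inner_add_right, inner_smul_left, inner_smul_right, smul_eq_mul, RCLike.conj_to_real] at h ⊢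
  nlinarith [h]

/-- The finite case of Minty's theorem, up to `δ`. If it failed, separating the values of the convex
functions `ξ ↦ ⟪B ξ + q i - η, ξ - ζ i⟫` from `{a | ∀ i, a i < δ}` would give weights `t i ≥ 0`;
monotonicity is contradicted at the barycentre of the points `ζ i`. -/
lemma exists_forall_inner_lt {ι : Type*} [Fintype ι] {B : F →ₗ[ℝ] F}
    (hB : ∀ x, 0 ≤ inner ℝ (B x) x) (η : F) (ζ q : ι → F)
    (hmon : ∀ i j, 0 ≤ inner ℝ (q i - q j) (ζ i - ζ j)) {δ : ℝ} (hδ : 0 < δ) :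
    ∃ ξ, ∀ i, inner ℝ (B ξ + (q i - η)) (ξ - ζ i) < δ := by
  classical
  by_contra! hcon
  -- `T` is the upward closure of the set of values
  let S : Set (ι → ℝ) := Set.univ.pi fun _ => Set.Iio δ
  let T : Set (ι → ℝ) := {a | ∃ ξ, ∀ i, inner ℝ (B ξ + (q i - η)) (ξ - ζ i) ≤ a i}
  have hS : Convex ℝ S := convex_pi fun _ _ => convex_Iio δ
  have hSo : IsOpen S := isOpen_set_pi Set.finite_univ fun _ _ => isOpen_Iio
  have hT : Convex ℝ T := by
    rintro a ⟨x, hx⟩ b ⟨y, hy⟩ s t hs ht hst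
    refine ⟨s • x + t • y, fun i => ?_⟩
    refine ((convexOn_inner_add_sub hB (q i - η) (ζ i)).2 trivial trivial hs ht hst).trans ?_
    simp only [smul_eq_mul, Pi.add_apply, Pi.smul_apply]
    exact add_le_add (mul_le_mul_of_nonneg_left (hx i) hs) (mul_le_mul_of_nonneg_left (hy i) ht)
  have hdis : Disjoint S T := by
    rw [Set.disjoint_left]
    rintro a ha ⟨ξ, hξ⟩
    obtain ⟨i, hi⟩ := hcon ξ
    exact absurd (ha i trivial) (not_lt.2 (hi.trans (hξ i)))
  obtain ⟨φ, u, hφS, hφT⟩ := geometric_hahn_banach_open hS hSo hT hdis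
  have hu : 0 < u := by
    have := hφS 0 fun i _ => hδ
    simpa using this
  set t : ι → ℝ := fun i => φ (Pi.single i 1) with ht_def
  have hφ : ∀ a, φ a = ∑ i, a i * t i := fun a => by
    conv_lhs => rw [pi_eq_sum_univ' a]
    simp [ht_def, map_sum]
  -- `T` is upward closed and `φ` is bounded below on it, so the weights are nonnegative
  have ht : ∀ i, 0 ≤ t i := by
    intro i
    by_contra! hneg
    let a₀ : ι → ℝ := fun j => inner ℝ (B 0 + (q j - η)) (0 - ζ j)
    have key : ∀ K : ℝ, 0 ≤ K → u ≤ φ a₀ + K * t i := by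
      intro K hK
      have h1 : a₀ + K • (Pi.single i (1 : ℝ) : ι → ℝ) ∈ T := by
        refine ⟨0, fun j => ?_⟩
        have : 0 ≤ K * (Pi.single i (1 : ℝ) : ι → ℝ) j :=
          mul_nonneg hK (by by_cases h : j = i <;> simp [h])
        simpa [a₀] using this
      have := hφT _ h1
      simpa [map_add, map_smul, ht_def] using this
    have h0 := key 0 le_rfl
    have h1 := key ((φ a₀ + 1) / (-t i)) (div_nonneg (by linarith) (by linarith))
    have h2 : (φ a₀ + 1) / (-t i) * t i = -(φ a₀ + 1) := by
      rw [div_neg, neg_mul, div_mul_cancel₀ _ hneg.ne]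
    linarith
  have hsum0 : 0 ≤ ∑ i, t i := Finset.sum_nonneg fun i _ => ht i
  have hmem : ∀ ξ, u ≤ ∑ i, t i * inner ℝ (B ξ + (q i - η)) (ξ - ζ i) := by
    intro ξ
    have := hφT (fun i => inner ℝ (B ξ + (q i - η)) (ξ - ζ i)) ⟨ξ, fun i => le_rfl⟩
    rw [hφ] at this
    simpa [mul_comm] using this
  rcases hsum0.eq_or_lt with h0 | hpos
  · have hz : ∀ i, t i = 0 := fun i =>
      (Finset.sum_eq_zero_iff_of_nonneg fun i _ => ht i).1 h0.symm i (Finset.mem_univ i)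
    have := hmem 0
    simp [hz] at this
    linarith
  · set τ := ∑ i, t i with hτ
    let ξ : F := τ⁻¹ • ∑ i, t i • ζ i
    have hξ : τ • ξ = ∑ i, t i • ζ i := by simp [ξ, smul_smul, hpos.ne']
    have e1 : ∑ i, t i * inner ℝ (B ξ - η) (ξ - ζ i) = 0 := by
      have : ∑ i, t i * inner ℝ (B ξ - η) (ξ - ζ i)
          = inner ℝ (B ξ - η) (τ • ξ - ∑ i, t i • ζ i) := by
        rw [hτ, Finset.sum_smul, ← Finset.sum_sub_distrib, inner_sum]
        simp only [← smul_sub, inner_smul_right]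
      rw [this, hξ, sub_self, inner_zero_right]
    have e2 : τ * ∑ i, t i * inner ℝ (q i) (ξ - ζ i)
        = ∑ i, ∑ j, t i * t j * inner ℝ (q i) (ζ j - ζ i) := by
      rw [Finset.mul_sum]
      refine Finset.sum_congr rfl fun i _ => ?_
      have : τ * (t i * inner ℝ (q i) (ξ - ζ i)) = t i * inner ℝ (q i) (τ • ξ - τ • ζ i) := by
        rw [← smul_sub, inner_smul_right]; ring
      rw [this, hξ, hτ, Finset.sum_smul, ← Finset.sum_sub_distrib, inner_sum, Finset.mul_sum]
      refine Finset.sum_congr rfl fun j _ => ?_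
      rw [← smul_sub, inner_smul_right]; ring
    -- symmetrize the double sum in `i` and `j` and use the monotonicity of the pairs
    have e3 : (∑ i, ∑ j, t i * t j * inner ℝ (q i) (ζ j - ζ i))
        + ∑ i, ∑ j, t i * t j * inner ℝ (q i) (ζ j - ζ i) ≤ 0 := by
      nth_rewrite 2 [Finset.sum_comm]
      rw [← Finset.sum_add_distrib]
      refine Finset.sum_nonpos fun i _ => ?_
      rw [← Finset.sum_add_distrib]
      refine Finset.sum_nonpos fun j _ => ?_
      have h := mul_nonneg (mul_nonneg (ht i) (ht j)) (hmon i j)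
      have : inner ℝ (q i - q j) (ζ i - ζ j)
          = -(inner ℝ (q i) (ζ j - ζ i) + inner ℝ (q j) (ζ i - ζ j)) := by
        simp only [inner_sub_left, inner_sub_right]; ring
      rw [this] at h
      nlinarith [h]
    have e4 : ∑ i, t i * inner ℝ (q i) (ξ - ζ i) ≤ 0 := by
      by_contra! h
      have := mul_pos hpos h
      linarith
    have e5 : ∑ i, t i * inner ℝ (B ξ + (q i - η)) (ξ - ζ i)
        = ∑ i, t i * inner ℝ (B ξ - η) (ξ - ζ i) + ∑ i, t i * inner ℝ (q i) (ξ - ζ i) := by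
      rw [← Finset.sum_add_distrib]
      refine Finset.sum_congr rfl fun i _ => ?_
      rw [← mul_add, ← inner_add_left]
      congr 2
      abel
    have := hmem ξ
    linarith

/-- Minty's theorem for the sum of a maximal monotone relation of type `γ` and a linear operator
that is bounded below by more than `γ`. -/
theorem IsMaximalMonotoneRel.exists_mem_sub [FiniteDimensional ℝ F] {γ ε : ℝ} {Θ : Set (F × F)}
    (hΘ : IsMaximalMonotoneRel γ Θ) (hε : 0 < ε) {B : F →ₗ[ℝ] F}
    (hB : ∀ x, (γ + ε) * ‖x‖ ^ 2 ≤ inner ℝ (B x) x) (η : F) :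
    ∃ ξ, (ξ, η - B ξ) ∈ Θ := by
  classical
  set B' : F →ₗ[ℝ] F := B - γ • LinearMap.id with hB'
  have hB'ε : ∀ x, ε * ‖x‖ ^ 2 ≤ inner ℝ (B' x) x := fun x => by
    have := hB x
    simp only [hB', LinearMap.sub_apply, LinearMap.smul_apply, LinearMap.id_apply, inner_sub_left,
      inner_smul_left, real_inner_self_eq_norm_sq, RCLike.conj_to_real]
    linarith
  have hB'0 : ∀ x, 0 ≤ inner ℝ (B' x) x := fun x => (by positivity : 0 ≤ ε * ‖x‖ ^ 2).trans (hB'ε x)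
  let f : F × F → F → ℝ := fun p ξ => inner ℝ (B' ξ + (p.2 + γ • p.1 - η)) (ξ - p.1)
  have hBc : Continuous B' := B'.continuous_of_finiteDimensional
  have hfc : ∀ p, Continuous (f p) := fun p => by fun_prop
  have hmon : ∀ p ∈ Θ, ∀ q ∈ Θ,
      0 ≤ inner ℝ ((p.2 + γ • p.1) - (q.2 + γ • q.1)) (p.1 - q.1) := fun p hp q hq => by
    have h := hΘ.1 p hp q hq
    have : (p.2 + γ • p.1) - (q.2 + γ • q.1) = (p.2 - q.2) + γ • (p.1 - q.1) := by
      rw [smul_sub]; abel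
    rw [this, inner_add_left, inner_smul_left, real_inner_self_eq_norm_sq]
    simp only [RCLike.conj_to_real]
    linarith
  -- a maximal relation is nonempty because the singleton of the origin is monotone
  obtain ⟨p₀, hp₀⟩ : Θ.Nonempty := by
    by_contra hne
    rw [Set.not_nonempty_iff_eq_empty] at hne
    have := hΘ.2 {(0, 0)} (by rintro p rfl q rfl; simp) (by simp [hne])
    rw [hne] at this
    exact (Set.singleton_ne_empty _ this)
  -- strong monotonicity of `B'` makes this sublevel set bounded
  have hcpt : IsCompact {ξ | f p₀ ξ ≤ 1} := by
    refine Metric.isCompact_of_isClosed_isBounded (isClosed_le (hfc p₀) continuous_const) ?_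
    set c := B' p₀.1 + (p₀.2 + γ • p₀.1 - η) with hc
    refine (Metric.isBounded_closedBall (x := p₀.1) (r := max 1 ((‖c‖ + 1) / ε))).subset ?_
    intro ξ hξ
    rw [Metric.mem_closedBall, dist_eq_norm]
    rcases le_total ‖ξ - p₀.1‖ 1 with h1 | h1
    · exact h1.trans (le_max_left _ _)
    refine le_trans ?_ (le_max_right _ _)
    rw [le_div_iff₀ hε]
    have h2 := hB'ε (ξ - p₀.1)
    have h3 : f p₀ ξ = inner ℝ (B' (ξ - p₀.1)) (ξ - p₀.1) + inner ℝ c (ξ - p₀.1) := by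
      simp only [f, hc, map_sub, ← inner_add_left]
      congr 1
      abel
    have h4 : -(‖c‖ * ‖ξ - p₀.1‖) ≤ inner ℝ c (ξ - p₀.1) :=
      neg_le_of_abs_le (abs_real_inner_le_norm _ _)
    have h5 : f p₀ ξ ≤ 1 := hξ
    have h6 : ε * ‖ξ - p₀.1‖ ^ 2 ≤ (‖c‖ + 1) * ‖ξ - p₀.1‖ := by nlinarith [norm_nonneg c]
    nlinarith [h6]
  let C : Θ × Set.Ioi (0 : ℝ) → Set F := fun i => {ξ | f i.1 ξ ≤ i.2}
  obtain ⟨ξ, -, hξ⟩ : ({ξ | f p₀ ξ ≤ 1} ∩ ⋂ i, C i).Nonempty := by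
    refine hcpt.inter_iInter_nonempty C (fun i => isClosed_le (hfc _) continuous_const) fun s => ?_
    let i₀ : Θ × Set.Ioi (0 : ℝ) := (⟨p₀, hp₀⟩, ⟨1, Set.mem_Ioi.2 one_pos⟩)
    obtain ⟨δ, hδ, hδs⟩ : ∃ δ : ℝ, 0 < δ ∧ ∀ i ∈ insert i₀ s, δ ≤ (i.2 : ℝ) := by
      obtain ⟨i, hi, him⟩ := Finset.exists_min_image (insert i₀ s) (fun i => (i.2 : ℝ))
        (Finset.insert_nonempty _ _)
      exact ⟨i.2, i.2.2, him⟩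
    obtain ⟨ξ, hξ⟩ := exists_forall_inner_lt (ι := (insert i₀ s : Finset _))
      hB'0 η (fun i => (i : Θ × Set.Ioi (0 : ℝ)).1.1.1)
      (fun i => (i : Θ × Set.Ioi (0 : ℝ)).1.1.2 + γ • (i : Θ × Set.Ioi (0 : ℝ)).1.1.1)
      (fun i j => hmon _ (i : Θ × Set.Ioi (0 : ℝ)).1.2 _ (j : Θ × Set.Ioi (0 : ℝ)).1.2) hδ
    refine ⟨ξ, ?_, ?_⟩
    · exact ((hξ ⟨_, Finset.mem_insert_self _ _⟩).le.trans
        (hδs _ (Finset.mem_insert_self _ _)))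
    · rw [Set.mem_iInter₂]
      intro i hi
      exact (hξ ⟨i, Finset.mem_insert_of_mem hi⟩).le.trans (hδs i (Finset.mem_insert_of_mem hi))
  have hξ0 : ∀ p ∈ Θ, f p ξ ≤ 0 := fun p hp =>
    le_of_forall_pos_le_add fun δ hδ => by
      have : f p ξ ≤ δ := Set.mem_iInter.1 hξ (⟨p, hp⟩, ⟨δ, hδ⟩)
      simpa using this
  refine ⟨ξ, ?_⟩
  have hrel : ∀ p ∈ Θ, -γ * ‖ξ - p.1‖ ^ 2 ≤ inner ℝ (η - B ξ - p.2) (ξ - p.1) := fun p hp => by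
    have h := hξ0 p hp
    have : B' ξ + (p.2 + γ • p.1 - η) = -(η - B ξ - p.2) - γ • (ξ - p.1) := by
      simp only [hB', LinearMap.sub_apply, LinearMap.smul_apply, LinearMap.id_apply, smul_sub]
      abel
    simp only [f, this, inner_sub_left (_ : F), inner_neg_left, inner_smul_left,
      RCLike.conj_to_real] at h
    have h' : inner ℝ (ξ - p.1) (ξ - p.1) = ‖ξ - p.1‖ ^ 2 := real_inner_self_eq_norm_sq _
    simp only [inner_sub_left] at h h' ⊢
    rw [h'] at h
    linarith
  -- the pair is monotonically related to `Θ`, hence belongs to it by maximality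
  have := hΘ.2 (insert (ξ, η - B ξ) Θ) ?_ (Set.subset_insert _ _)
  · rw [← this]; exact Set.mem_insert _ _
  · rintro p (rfl | hp) q (rfl | hq)
    · simp
    · exact hrel q hq
    · have := hrel p hp
      rw [← inner_neg_neg, neg_sub, neg_sub, norm_sub_rev]
      exact this
    · exact hΘ.1 p hp q hq

end Minty

/-! ### Test functions and the regularized Yukawa kernel -/

section Kernel

lemma IsTest.continuous {φ : E3 → ℝ} (hφ : IsTest φ) : Continuous φ := hφ.1.continuous

lemma IsTest.fderiv_apply {φ : E3 → ℝ} (hφ : IsTest φ) (v : E3) :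
    IsTest fun x => fderiv ℝ φ x v :=
  ⟨(hφ.1.fderiv_right (m := (⊤ : ℕ∞)) (by simp)).clm_apply contDiff_const,
    hφ.2.fderiv_apply ℝ v⟩

lemma iteratedFDeriv_two_eq_fderiv_fderiv {φ : E3 → ℝ} (hφ : ContDiff ℝ (⊤ : ℕ∞) φ) (x v w : E3) :
    iteratedFDeriv ℝ 2 φ x ![v, w] = fderiv ℝ (fun z => fderiv ℝ φ z w) x v := by
  rw [iteratedFDeriv_two_apply, fderiv_clm_apply]
  · simp
  · exact ((hφ.fderiv_right (m := (⊤ : ℕ∞)) (by simp)).differentiable (by simp)).differentiableAt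
  · exact differentiableAt_const _

lemma laplacian_eq_sum_iteratedFDeriv (φ : E3 → ℝ) (x : E3) :
    Laplacian.laplacian φ x = ∑ i, iteratedFDeriv ℝ 2 φ x ![unitVec i, unitVec i] := by
  rw [InnerProductSpace.laplacian_eq_iteratedFDeriv_orthonormalBasis φ
    (EuclideanSpace.basisFun (Fin 3) ℝ)]
  simp [unitVec]

lemma laplacian_eq_sum_fderiv {φ : E3 → ℝ} (hφ : ContDiff ℝ (⊤ : ℕ∞) φ) (x : E3) :
    Laplacian.laplacian φ x
      = ∑ i, fderiv ℝ (fun z => fderiv ℝ φ z (unitVec i)) x (unitVec i) := by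
  simp only [laplacian_eq_sum_iteratedFDeriv, iteratedFDeriv_two_eq_fderiv_fderiv hφ]

lemma IsTest.laplacian {φ : E3 → ℝ} (hφ : IsTest φ) : IsTest (Laplacian.laplacian φ) := by
  have h : Laplacian.laplacian φ
      = fun x => ∑ i, fderiv ℝ (fun z => fderiv ℝ φ z (unitVec i)) x (unitVec i) :=
    funext (laplacian_eq_sum_fderiv hφ.1)
  have hi := fun i : Fin 3 => (hφ.fderiv_apply (unitVec i)).fderiv_apply (unitVec i)
  rw [h]
  refine ⟨ContDiff.sum fun i _ => (hi i).1, ?_⟩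
  simp only [Fin.sum_univ_three]
  exact ((hi 0).2.add (hi 1).2).add (hi 2).2

/-- Negative powers of the distance to a point up to the second are locally integrable on `ℝ³`. -/
lemma locallyIntegrable_norm_sub_inv_pow (y : E3) {k : ℕ} (hk : k ≤ 2) :
    LocallyIntegrable (fun x : E3 => ‖x - y‖⁻¹ ^ k) := by
  intro z
  refine ⟨Metric.ball y (dist z y + 1), Metric.isOpen_ball.mem_nhds (by simp), ?_⟩
  have h0 : IntegrableOn (fun x : E3 => ‖x‖⁻¹ ^ k) (Metric.ball 0 (dist z y + 1)) := by
    refine (integrableOn_fun_norm_addHaar (volume : Measure E3) (f := fun r : ℝ => r⁻¹ ^ k)).2 ?_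
    have : IntegrableOn (fun r : ℝ => r ^ (2 - k)) (Set.Ioo 0 (dist z y + 1)) :=
      ((continuous_pow _).integrableOn_Icc).mono_set Set.Ioo_subset_Icc_self
    refine this.congr_fun (fun r hr => ?_) measurableSet_Ioo
    have hr0 : r ≠ 0 := hr.1.ne'
    simp only [finrank_euclideanSpace, Fintype.card_fin, smul_eq_mul]
    rw [pow_sub₀ _ hr0 hk, inv_pow]
  have h1 := (measurePreserving_sub_right (volume : Measure E3) y).integrableOn_comp_preimage
    (measurableEmbedding_subRight y) (f := fun x : E3 => ‖x‖⁻¹ ^ k)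
    (s := Metric.ball 0 (dist z y + 1))
  have h2 := h1.2 h0
  refine h2.mono_set fun x hx => ?_
  simpa [dist_eq_norm] using hx

lemma integrable_mul_of_norm_le_norm_sub_inv_pow {y : E3} {k : ℕ} (hk : k ≤ 2) {C : ℝ}
    {F φ : E3 → ℝ} (hF : AEStronglyMeasurable F) (hb : ∀ x, x ≠ y → ‖F x‖ ≤ C * ‖x - y‖⁻¹ ^ k)
    (hφ : Continuous φ) (hφs : HasCompactSupport φ) :
    Integrable fun x => F x * φ x := by
  have h := ((locallyIntegrable_norm_sub_inv_pow y hk).integrable_smul_right_of_hasCompactSupport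
    hφ hφs).norm.const_mul C
  refine h.mono' (hF.mul hφ.aestronglyMeasurable) ?_
  have : ∀ᵐ x : E3, x ≠ y := by simp [ae_iff]
  filter_upwards [this] with x hx
  rw [norm_mul, smul_eq_mul, norm_mul, ← mul_assoc, norm_pow, norm_inv, norm_norm]
  exact mul_le_mul_of_nonneg_right (hb x hx) (norm_nonneg _)

/-- Dominated convergence against a compactly supported continuous function, for functions with a
singularity that is at most quadratic. -/
lemma tendsto_integral_mul_of_norm_le_norm_sub_inv_pow {y : E3} {k : ℕ} (hk : k ≤ 2) {C : ℝ}
    {F : ℝ → E3 → ℝ} {F₀ φ : E3 → ℝ} (hF : ∀ ε > 0, Continuous (F ε))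
    (hb : ∀ ε > 0, ∀ x, x ≠ y → ‖F ε x‖ ≤ C * ‖x - y‖⁻¹ ^ k)
    (hlim : ∀ x, x ≠ y → Tendsto (fun ε => F ε x) (𝓝[>] 0) (𝓝 (F₀ x)))
    (hφ : Continuous φ) (hφs : HasCompactSupport φ) :
    Tendsto (fun ε => ∫ x, F ε x * φ x) (𝓝[>] 0) (𝓝 (∫ x, F₀ x * φ x)) := by
  have hne : ∀ᵐ x : E3, x ≠ y := by simp [ae_iff]
  refine tendsto_integral_filter_of_dominated_convergence
    (fun x => C * ‖‖x - y‖⁻¹ ^ k • φ x‖) ?_ ?_ ?_ ?_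
  · filter_upwards [self_mem_nhdsWithin] with ε hε
    exact ((hF ε hε).mul hφ).aestronglyMeasurable
  · filter_upwards [self_mem_nhdsWithin] with ε hε
    filter_upwards [hne] with x hx
    rw [norm_mul, smul_eq_mul, norm_mul, ← mul_assoc, norm_pow, norm_inv, norm_norm]
    exact mul_le_mul_of_nonneg_right (hb ε hε x hx) (norm_nonneg _)
  · exact ((locallyIntegrable_norm_sub_inv_pow y hk).integrable_smul_right_of_hasCompactSupport
      hφ hφs).norm.const_mul C
  · filter_upwards [hne] with x hx
    exact (hlim x hx).mul_const _

lemma integral_mul_fderiv_eq_neg {f : E3 → ℝ} {f' : E3 → E3 →L[ℝ] ℝ} (hf : Continuous f)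
    (hfd : ∀ x, HasFDerivAt f (f' x) x) {v : E3} (hf' : Continuous fun x => f' x v)
    {φ : E3 → ℝ} (hφ : IsTest φ) :
    ∫ x, f x * fderiv ℝ φ x v = -∫ x, f' x v * φ x := by
  refine integral_bilinear_hasFDerivAt_right_eq_neg_left_of_integrable
    (B := ContinuousLinearMap.mul ℝ ℝ) ?_ ?_ ?_ (fun x _ => hfd x)
    (fun x _ => (hφ.1.differentiable (by simp) x).hasFDerivAt)
  · exact (hf'.mul hφ.continuous).integrable_of_hasCompactSupport hφ.2.mul_left
  · exact (hf.mul (hφ.fderiv_apply v).continuous).integrable_of_hasCompactSupport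
      (hφ.fderiv_apply v).2.mul_left
  · exact (hf.mul hφ.continuous).integrable_of_hasCompactSupport hφ.2.mul_left

/-- The distance to `y`, regularized to the smooth function `√(‖x - y‖² + ε²)`. -/
noncomputable def softDist (ε : ℝ) (y x : E3) : ℝ := √(‖x - y‖ ^ 2 + ε ^ 2)

lemma softDist_sq (ε : ℝ) (y x : E3) : softDist ε y x ^ 2 = ‖x - y‖ ^ 2 + ε ^ 2 :=
  Real.sq_sqrt (by positivity)

lemma softDist_pos {ε : ℝ} (hε : 0 < ε) (y x : E3) : 0 < softDist ε y x :=
  Real.sqrt_pos.2 (by positivity)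

lemma norm_sub_le_softDist (ε : ℝ) (y x : E3) : ‖x - y‖ ≤ softDist ε y x :=
  Real.le_sqrt_of_sq_le (by nlinarith [sq_nonneg ε])

lemma le_softDist (ε : ℝ) (y x : E3) : ε ≤ softDist ε y x :=
  Real.le_sqrt_of_sq_le (by nlinarith [sq_nonneg ‖x - y‖])

lemma tendsto_softDist (y x : E3) :
    Tendsto (fun ε => softDist ε y x) (𝓝[>] 0) (𝓝 ‖x - y‖) := by
  have : Continuous fun ε => softDist ε y x := by unfold softDist; fun_prop
  have h := this.tendsto 0
  simp only [softDist, ne_eq, OfNat.ofNat_ne_zero, not_false_eq_true, zero_pow, add_zero] at h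
  rw [Real.sqrt_sq (norm_nonneg _)] at h
  exact h.mono_left nhdsWithin_le_nhds

@[fun_prop]
lemma continuous_softDist (ε : ℝ) (y : E3) : Continuous (softDist ε y) := by
  unfold softDist; fun_prop

lemma hasFDerivAt_comp_softDist {ε : ℝ} (hε : 0 < ε) {g : ℝ → ℝ} {g' : ℝ} {y x : E3}
    (hg : HasDerivAt g g' (softDist ε y x)) :
    HasFDerivAt (fun z => g (softDist ε y z)) ((g' / softDist ε y x) • innerSL ℝ (x - y)) x := by
  have h1 : HasFDerivAt (fun z : E3 => ‖z - y‖ ^ 2 + ε ^ 2) (2 • innerSL ℝ (x - y)) x := by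
    have := ((hasFDerivAt_id x).sub_const y).norm_sq.add_const (ε ^ 2)
    simpa using this
  have h2 := hg.comp_hasFDerivAt x (h1.sqrt (by positivity))
  convert! h2 using 1
  ext v
  simp only [softDist, smul_apply, smul_eq_mul, nsmul_eq_mul]
  push_cast
  ring

/-- The profile `e^{-as} / s` of the Green function, up to the factor `1 / 4π`. -/
noncomputable def yukawa (a s : ℝ) : ℝ := Real.exp (-a * s) / s

/-- The function `s ↦ -(yukawa a)'(s) / s`, so that `∇ (yukawa a ‖·‖) x = -yukawaSlope a ‖x‖ • x`. -/
noncomputable def yukawaSlope (a s : ℝ) : ℝ := (1 + a * s) * Real.exp (-a * s) / s ^ 3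

lemma hasDerivAt_exp_neg_mul (a s : ℝ) :
    HasDerivAt (fun s => Real.exp (-a * s)) (-a * Real.exp (-a * s)) s := by
  simpa [mul_comm] using ((hasDerivAt_id s).const_mul (-a)).exp

lemma hasDerivAt_yukawa (a : ℝ) {s : ℝ} (hs : s ≠ 0) :
    HasDerivAt (yukawa a) (-yukawaSlope a s * s) s := by
  convert! (hasDerivAt_exp_neg_mul a s).div (hasDerivAt_id s) hs using 1
  simp only [yukawaSlope, id]
  field_simp
  ring

lemma hasDerivAt_yukawaSlope (a : ℝ) {s : ℝ} (hs : s ≠ 0) :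
    HasDerivAt (yukawaSlope a)
      (-(a ^ 2 * Real.exp (-a * s) / s ^ 3
        + 3 * ((1 + a * s) * Real.exp (-a * s)) / s ^ 5) * s) s := by
  have h1 : HasDerivAt (fun s => 1 + a * s) a s := by
    simpa using ((hasDerivAt_id s).const_mul a).const_add 1
  convert! (h1.mul (hasDerivAt_exp_neg_mul a s)).div (hasDerivAt_pow 3 s) (pow_ne_zero 3 hs) using 1
  simp only [Pi.mul_apply]
  field_simp
  push_cast
  ring

lemma one_add_mul_exp_neg_le_one {t : ℝ} : (1 + t) * Real.exp (-t) ≤ 1 := by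
  have h := Real.add_one_le_exp t
  have h2 : Real.exp t * Real.exp (-t) = 1 := by rw [← Real.exp_add]; simp
  nlinarith [Real.exp_pos (-t)]

lemma continuousAt_yukawa (a : ℝ) {s : ℝ} (hs : s ≠ 0) : ContinuousAt (yukawa a) s :=
  (hasDerivAt_yukawa a hs).continuousAt

lemma continuousAt_yukawaSlope (a : ℝ) {s : ℝ} (hs : s ≠ 0) : ContinuousAt (yukawaSlope a) s :=
  (hasDerivAt_yukawaSlope a hs).continuousAt

lemma yukawa_nonneg (a : ℝ) {s : ℝ} (hs : 0 ≤ s) : 0 ≤ yukawa a s :=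
  div_nonneg (Real.exp_pos _).le hs

lemma yukawa_le_inv {a s r : ℝ} (ha : 0 ≤ a) (hr : 0 < r) (hrs : r ≤ s) : yukawa a s ≤ r⁻¹ := by
  have hs : 0 < s := hr.trans_le hrs
  have h1 : Real.exp (-a * s) ≤ 1 := Real.exp_le_one_iff.2 (by nlinarith)
  calc yukawa a s ≤ 1 / s := div_le_div_of_nonneg_right h1 hs.le
    _ ≤ r⁻¹ := by rw [one_div]; exact inv_anti₀ hr hrs

lemma yukawaSlope_nonneg {a s : ℝ} (ha : 0 ≤ a) (hs : 0 ≤ s) : 0 ≤ yukawaSlope a s := by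
  unfold yukawaSlope; positivity

lemma yukawaSlope_mul_le_inv_sq {a s r : ℝ} (hr : 0 < r) (hrs : r ≤ s) :
    yukawaSlope a s * r ≤ r⁻¹ ^ 2 := by
  have hs : 0 < s := hr.trans_le hrs
  have h1 : (1 + a * s) * Real.exp (-a * s) ≤ 1 := by
    rw [neg_mul]; exact one_add_mul_exp_neg_le_one
  have h3 : r ^ 3 ≤ s ^ 3 := pow_le_pow_left₀ hr.le hrs 3
  calc yukawaSlope a s * r ≤ 1 / s ^ 3 * r :=
        mul_le_mul_of_nonneg_right (div_le_div_of_nonneg_right h1 (by positivity)) hr.le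
    _ ≤ 1 / r ^ 3 * r :=
        mul_le_mul_of_nonneg_right (one_div_le_one_div_of_le (by positivity) h3) hr.le
    _ = r⁻¹ ^ 2 := by field_simp

lemma inner_unitVec (x : E3) (i : Fin 3) : inner ℝ x (unitVec i) = x i := by
  simp [unitVec, EuclideanSpace.inner_single_right]

lemma continuous_comp_softDist {ε : ℝ} (hε : 0 < ε) (y : E3) {g : ℝ → ℝ}
    (hg : ∀ s, 0 < s → ContinuousAt g s) : Continuous fun x => g (softDist ε y x) :=
  continuous_iff_continuousAt.2 fun x =>
    (hg _ (softDist_pos hε y x)).comp (continuous_softDist ε y).continuousAt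

lemma abs_sub_apply_le (x y : E3) (i : Fin 3) : |(x - y) i| ≤ ‖x - y‖ := by
  simpa using PiLp.norm_apply_le (x - y) i

/-- The distributional gradient of `x ↦ yukawa a ‖x - y‖` is its pointwise gradient. -/
lemma integral_yukawa_mul_fderiv {a : ℝ} (ha : 0 ≤ a) (y : E3) (i : Fin 3) {φ : E3 → ℝ}
    (hφ : IsTest φ) :
    ∫ x, yukawa a ‖x - y‖ * fderiv ℝ φ x (unitVec i)
      = ∫ x, yukawaSlope a ‖x - y‖ * (x - y) i * φ x := by
  have hcy : ∀ ε > 0, Continuous fun x => yukawa a (softDist ε y x) := fun ε hε =>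
    continuous_comp_softDist hε y fun s hs => continuousAt_yukawa a hs.ne'
  have hcs : ∀ ε > 0, Continuous fun x => yukawaSlope a (softDist ε y x) * (x - y) i :=
    fun ε hε => (continuous_comp_softDist hε y fun s hs =>
      continuousAt_yukawaSlope a hs.ne').mul (by fun_prop)
  have hL := tendsto_integral_mul_of_norm_le_norm_sub_inv_pow (y := y) (k := 1) (by norm_num)
    (C := 1) (F := fun ε x => yukawa a (softDist ε y x)) (F₀ := fun x => yukawa a ‖x - y‖) hcy
    (fun ε hε x hx => by
      have hr : 0 < ‖x - y‖ := norm_pos_iff.2 (sub_ne_zero.2 hx)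
      rw [Real.norm_of_nonneg (yukawa_nonneg a (softDist_pos hε y x).le), one_mul, pow_one]
      exact yukawa_le_inv ha hr (norm_sub_le_softDist ε y x))
    (fun x hx => (continuousAt_yukawa a (norm_ne_zero_iff.2 (sub_ne_zero.2 hx))).tendsto.comp
      (tendsto_softDist y x))
    (hφ.fderiv_apply (unitVec i)).continuous (hφ.fderiv_apply (unitVec i)).2
  have hR := tendsto_integral_mul_of_norm_le_norm_sub_inv_pow (y := y) (k := 2) le_rfl
    (C := 1) (F := fun ε x => yukawaSlope a (softDist ε y x) * (x - y) i)
    (F₀ := fun x => yukawaSlope a ‖x - y‖ * (x - y) i) hcs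
    (fun ε hε x hx => by
      have hr : 0 < ‖x - y‖ := norm_pos_iff.2 (sub_ne_zero.2 hx)
      have hn := yukawaSlope_nonneg ha (softDist_pos hε y x).le
      rw [one_mul, norm_mul, Real.norm_of_nonneg hn]
      exact (mul_le_mul_of_nonneg_left (abs_sub_apply_le x y i) hn).trans
        (yukawaSlope_mul_le_inv_sq hr (norm_sub_le_softDist ε y x)))
    (fun x hx => ((continuousAt_yukawaSlope a
      (norm_ne_zero_iff.2 (sub_ne_zero.2 hx))).tendsto.comp
      (tendsto_softDist y x)).mul_const _)
    hφ.continuous hφ.2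
  refine tendsto_nhds_unique hL (hR.congr' ?_)
  filter_upwards [self_mem_nhdsWithin] with ε hε
  have hfd : ∀ x, HasFDerivAt (fun z => yukawa a (softDist ε y z))
      ((-yukawaSlope a (softDist ε y x)) • innerSL ℝ (x - y)) x := fun x => by
    have hs := (softDist_pos hε y x).ne'
    have := hasFDerivAt_comp_softDist hε (hasDerivAt_yukawa a hs)
    rwa [mul_div_cancel_right₀ _ hs] at this
  have hap : ∀ x, ((-yukawaSlope a (softDist ε y x)) • innerSL ℝ (x - y)) (unitVec i)
      = -(yukawaSlope a (softDist ε y x) * (x - y) i) := fun x => by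
    rw [smul_apply, innerSL_apply_apply, inner_unitVec]; simp
  rw [integral_mul_fderiv_eq_neg (hcy ε hε) hfd (by simp only [hap]; exact (hcs ε hε).neg) hφ]
  simp only [hap, neg_mul, integral_neg, neg_neg]

end Kernel

/-! ### The Green function as a fundamental solution -/

section Delta

/-- A radial primitive of `3 (1 + r²)^(-5/2)` on `ℝ³`, with respect to the weight `r²`. -/
lemma hasDerivAt_pow_div_sqrt_pow (r : ℝ) :
    HasDerivAt (fun r : ℝ => r ^ 3 / √(r ^ 2 + 1) ^ 3) (r ^ 2 * (3 / √(r ^ 2 + 1) ^ 5)) r := by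
  have hp : 0 < r ^ 2 + 1 := by positivity
  have hs : √(r ^ 2 + 1) ≠ 0 := (Real.sqrt_pos.2 hp).ne'
  have h1 : HasDerivAt (fun r : ℝ => r ^ 2 + 1) (2 * r) r := by
    simpa using (hasDerivAt_pow 2 r).add_const 1
  have h2 := (h1.sqrt hp.ne').pow 3
  convert! (hasDerivAt_pow 3 r).div h2 (pow_ne_zero 3 hs) using 1
  have hsq : √(r ^ 2 + 1) ^ 2 = r ^ 2 + 1 := Real.sq_sqrt hp.le
  have hsq4 : √(r ^ 2 + 1) ^ 4 = (r ^ 2 + 1) ^ 2 := by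
    rw [show 4 = 2 * 2 from rfl, pow_mul, hsq]
  simp only [Pi.pow_apply]
  field_simp
  push_cast
  simp only [hsq, hsq4]
  ring

lemma tendsto_pow_div_sqrt_pow :
    Tendsto (fun r : ℝ => r ^ 3 / √(r ^ 2 + 1) ^ 3) atTop (𝓝 1) := by
  have h1 : Tendsto (fun r : ℝ => (√(1 + r⁻¹ ^ 2) ^ 3)⁻¹) atTop (𝓝 (√(1 + 0 ^ 2) ^ 3)⁻¹) := by
    have hc : ContinuousAt (fun t : ℝ => (√(1 + t ^ 2) ^ 3)⁻¹) 0 := by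
      refine ContinuousAt.inv₀ (by fun_prop) ?_
      simp
    exact hc.tendsto.comp tendsto_inv_atTop_zero
  simp only [ne_eq, OfNat.ofNat_ne_zero, not_false_eq_true, zero_pow, add_zero, Real.sqrt_one,
    one_pow, inv_one] at h1
  refine h1.congr' ?_
  filter_upwards [eventually_gt_atTop 0] with r hr
  have : √(r ^ 2 + 1) = r * √(1 + r⁻¹ ^ 2) := by
    rw [← Real.sqrt_sq hr.le, ← Real.sqrt_mul (by positivity), Real.sqrt_sq hr.le]
    congr 1
    field_simp
  rw [this, mul_pow]
  have : √(1 + r⁻¹ ^ 2) ≠ 0 := (Real.sqrt_pos.2 (by positivity)).ne'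
  field_simp

lemma integrable_three_div_sqrt_pow :
    Integrable fun z : E3 => 3 / √(‖z‖ ^ 2 + 1) ^ 5 := by
  refine (integrable_fun_norm_addHaar (volume : Measure E3)
    (f := fun r : ℝ => 3 / √(r ^ 2 + 1) ^ 5)).2 ?_
  simp only [finrank_euclideanSpace, Fintype.card_fin, smul_eq_mul]
  change IntegrableOn (fun r : ℝ => r ^ 2 * (3 / √(r ^ 2 + 1) ^ 5)) _
  exact integrableOn_Ioi_deriv_of_nonneg' (fun r _ => hasDerivAt_pow_div_sqrt_pow r)
    (fun r _ => by positivity) tendsto_pow_div_sqrt_pow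

lemma integral_three_div_sqrt_pow :
    ∫ z : E3, 3 / √(‖z‖ ^ 2 + 1) ^ 5 = 4 * Real.pi := by
  rw [integral_fun_norm_addHaar (volume : Measure E3) (fun r : ℝ => 3 / √(r ^ 2 + 1) ^ 5)]
  simp only [finrank_euclideanSpace, Fintype.card_fin, smul_eq_mul]
  have h := integral_Ioi_of_hasDerivAt_of_nonneg' (a := 0)
    (fun r _ => hasDerivAt_pow_div_sqrt_pow r) (fun r _ => by positivity) tendsto_pow_div_sqrt_pow
  simp only [Nat.add_one_sub_one] at h ⊢
  rw [h, Measure.real, EuclideanSpace.volume_ball_fin_three]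
  have hpi : 0 ≤ Real.pi * 4 / 3 := by positivity
  simp [ENNReal.toReal_ofReal hpi]
  ring

/-- The functions `3 ε² (1 + a s) e^{-as} / s⁵`, with `s` the regularized distance to `y`,
approximate `4π` times the Dirac measure at `y`. -/
lemma tendsto_integral_approx_dirac {a : ℝ} (ha : 0 ≤ a) (y : E3) {φ : E3 → ℝ}
    (hφ : Continuous φ) (hφs : HasCompactSupport φ) :
    Tendsto (fun ε => ∫ x, 3 * ε ^ 2 * ((1 + a * softDist ε y x) * Real.exp (-a * softDist ε y x))
      / softDist ε y x ^ 5 * φ x) (𝓝[>] 0) (𝓝 (4 * Real.pi * φ y)) := by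
  obtain ⟨C, hC⟩ := hφs.exists_bound_of_continuous hφ
  have hC0 : 0 ≤ C := (norm_nonneg _).trans (hC 0)
  set m : ℝ → ℝ := fun t => (1 + t) * Real.exp (-t) with hm
  have hmc : Continuous m := by fun_prop
  have hlim : Tendsto (fun ε : ℝ => ∫ z : E3, 3 / √(‖z‖ ^ 2 + 1) ^ 5
      * (m (a * (ε * √(‖z‖ ^ 2 + 1))) * φ (y + ε • z))) (𝓝[>] 0)
      (𝓝 (∫ z : E3, 3 / √(‖z‖ ^ 2 + 1) ^ 5 * φ y)) := by
    have hσ : ∀ z : E3, √(‖z‖ ^ 2 + 1) ≠ 0 := fun z => (Real.sqrt_pos.2 (by positivity)).ne'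
    refine tendsto_integral_filter_of_dominated_convergence
      (fun z => 3 / √(‖z‖ ^ 2 + 1) ^ 5 * C) ?_ ?_ (integrable_three_div_sqrt_pow.mul_const C) ?_
    · filter_upwards with ε
      have : Continuous fun z : E3 => 3 / √(‖z‖ ^ 2 + 1) ^ 5 :=
        continuous_const.div (by fun_prop) fun z => pow_ne_zero 5 (hσ z)
      exact (this.mul ((hmc.comp (by fun_prop)).mul (hφ.comp (by fun_prop)))).aestronglyMeasurable
    · filter_upwards [self_mem_nhdsWithin] with ε hε
      refine Eventually.of_forall fun z => ?_
      have hε' : (0 : ℝ) < ε := hε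
      have ht : 0 ≤ a * (ε * √(‖z‖ ^ 2 + 1)) := by positivity
      have h1 : |m (a * (ε * √(‖z‖ ^ 2 + 1)))| ≤ 1 := by
        rw [abs_of_nonneg (by simp only [hm]; positivity)]
        exact one_add_mul_exp_neg_le_one
      rw [norm_mul, Real.norm_of_nonneg (by positivity : (0 : ℝ) ≤ 3 / √(‖z‖ ^ 2 + 1) ^ 5),
        norm_mul]
      refine mul_le_mul_of_nonneg_left ?_ (by positivity)
      calc _ ≤ 1 * C := mul_le_mul h1 (hC _) (norm_nonneg _) zero_le_one
        _ = C := one_mul C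
    · refine Eventually.of_forall fun z => Tendsto.const_mul _ ?_
      have hc : Continuous fun ε : ℝ => m (a * (ε * √(‖z‖ ^ 2 + 1))) * φ (y + ε • z) := by fun_prop
      have := hc.tendsto 0
      simp only [hm, zero_mul, mul_zero, add_zero, neg_zero, Real.exp_zero, mul_one, zero_smul,
        one_mul] at this
      exact this.mono_left nhdsWithin_le_nhds
  rw [integral_mul_const, integral_three_div_sqrt_pow] at hlim
  refine hlim.congr' ?_
  filter_upwards [self_mem_nhdsWithin] with ε hε
  have hε' : (0 : ℝ) < ε := hε
  -- substitute `x = y + ε z`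
  set f : E3 → ℝ := fun x => 3 * ε ^ 2 *
    ((1 + a * softDist ε y x) * Real.exp (-a * softDist ε y x)) / softDist ε y x ^ 5 * φ x with hf
  have hsub : ∫ x, f x = ε ^ 3 * ∫ z, f (y + ε • z) := by
    rw [Measure.integral_comp_smul volume (fun x => f (y + x)) ε, integral_add_left_eq_self f y]
    simp only [finrank_euclideanSpace, Fintype.card_fin, smul_eq_mul]
    rw [abs_of_pos (by positivity), ← mul_assoc, mul_inv_cancel₀ (by positivity), one_mul]
  rw [hsub, ← integral_const_mul]
  refine integral_congr_ae (Eventually.of_forall fun z => ?_)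
  have hs : softDist ε y (y + ε • z) = ε * √(‖z‖ ^ 2 + 1) := by
    simp only [softDist, add_sub_cancel_left, norm_smul, Real.norm_of_nonneg hε'.le]
    rw [← Real.sqrt_sq hε'.le, ← Real.sqrt_mul (by positivity), Real.sqrt_sq hε'.le]
    congr 1
    ring
  have hσ : √(‖z‖ ^ 2 + 1) ≠ 0 := (Real.sqrt_pos.2 (by positivity)).ne'
  simp only [hf, hs, hm]
  rw [neg_mul]
  field_simp

/-- The distributional divergence of `x ↦ yukawaSlope a ‖x - y‖ • (x - y)` is
`4π δ_y - a² yukawa a ‖x - y‖`. -/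
lemma sum_integral_yukawaSlope_mul_fderiv {a : ℝ} (ha : 0 ≤ a) (y : E3) {φ : E3 → ℝ}
    (hφ : IsTest φ) :
    ∑ i, ∫ x, yukawaSlope a ‖x - y‖ * (x - y) i * fderiv ℝ φ x (unitVec i)
      = a ^ 2 * (∫ x, yukawa a ‖x - y‖ * φ x) - 4 * Real.pi * φ y := by
  have hcs : ∀ ε > 0, Continuous fun x => yukawaSlope a (softDist ε y x) :=
    fun ε hε => continuous_comp_softDist hε y fun s hs => continuousAt_yukawaSlope a hs.ne'
  have hL : Tendsto (fun ε => ∑ i, ∫ x, yukawaSlope a (softDist ε y x) * (x - y) i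
      * fderiv ℝ φ x (unitVec i)) (𝓝[>] 0)
      (𝓝 (∑ i, ∫ x, yukawaSlope a ‖x - y‖ * (x - y) i * fderiv ℝ φ x (unitVec i))) :=
    tendsto_finsetSum _ fun i _ => tendsto_integral_mul_of_norm_le_norm_sub_inv_pow (y := y)
      (k := 2) le_rfl (C := 1) (F := fun ε x => yukawaSlope a (softDist ε y x) * (x - y) i)
      (F₀ := fun x => yukawaSlope a ‖x - y‖ * (x - y) i)
      (fun ε hε => (hcs ε hε).mul (by fun_prop))
      (fun ε hε x hx => by
        have hr : 0 < ‖x - y‖ := norm_pos_iff.2 (sub_ne_zero.2 hx)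
        have hn := yukawaSlope_nonneg ha (softDist_pos hε y x).le
        rw [one_mul, norm_mul, Real.norm_of_nonneg hn]
        exact (mul_le_mul_of_nonneg_left (abs_sub_apply_le x y i) hn).trans
          (yukawaSlope_mul_le_inv_sq hr (norm_sub_le_softDist ε y x)))
      (fun x hx => ((continuousAt_yukawaSlope a
        (norm_ne_zero_iff.2 (sub_ne_zero.2 hx))).tendsto.comp (tendsto_softDist y x)).mul_const _)
      (hφ.fderiv_apply (unitVec i)).continuous (hφ.fderiv_apply (unitVec i)).2
  have hcy : ∀ ε > 0, Continuous fun x => yukawa a (softDist ε y x) := fun ε hε =>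
    continuous_comp_softDist hε y fun s hs => continuousAt_yukawa a hs.ne'
  have hy := tendsto_integral_mul_of_norm_le_norm_sub_inv_pow (y := y) (k := 1) (by norm_num)
    (C := 1) (F := fun ε x => yukawa a (softDist ε y x)) (F₀ := fun x => yukawa a ‖x - y‖) hcy
    (fun ε hε x hx => by
      have hr : 0 < ‖x - y‖ := norm_pos_iff.2 (sub_ne_zero.2 hx)
      rw [Real.norm_of_nonneg (yukawa_nonneg a (softDist_pos hε y x).le), one_mul, pow_one]
      exact yukawa_le_inv ha hr (norm_sub_le_softDist ε y x))
    (fun x hx => (continuousAt_yukawa a (norm_ne_zero_iff.2 (sub_ne_zero.2 hx))).tendsto.comp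
      (tendsto_softDist y x)) hφ.continuous hφ.2
  have hcE : ∀ ε > 0, Continuous fun x =>
      ε ^ 2 * (Real.exp (-a * softDist ε y x) / softDist ε y x ^ 3) := fun ε hε =>
    continuous_const.mul ((by fun_prop : Continuous fun x =>
      Real.exp (-a * softDist ε y x)).div (by fun_prop) fun x =>
        pow_ne_zero 3 (softDist_pos hε y x).ne')
  have hE := tendsto_integral_mul_of_norm_le_norm_sub_inv_pow (y := y) (k := 1) (by norm_num)
    (C := 1) (F := fun ε x => ε ^ 2 * (Real.exp (-a * softDist ε y x) / softDist ε y x ^ 3))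
    (F₀ := fun _ => 0) hcE
    (fun ε hε x hx => by
      have hr : 0 < ‖x - y‖ := norm_pos_iff.2 (sub_ne_zero.2 hx)
      have hs := softDist_pos hε y x
      have h1 : ε ^ 2 / softDist ε y x ^ 2 ≤ 1 :=
        div_le_one_of_le₀ (pow_le_pow_left₀ (le_of_lt hε) (le_softDist ε y x) 2) (by positivity)
      have h2 := yukawa_le_inv ha hr (norm_sub_le_softDist ε y x)
      have h3 : ε ^ 2 * (Real.exp (-a * softDist ε y x) / softDist ε y x ^ 3)
          = ε ^ 2 / softDist ε y x ^ 2 * yukawa a (softDist ε y x) := by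
        unfold yukawa; field_simp
      rw [Real.norm_of_nonneg (by positivity), h3, pow_one]
      exact mul_le_mul h1 h2 (yukawa_nonneg a hs.le) zero_le_one)
    (fun x hx => by
      have hr : ‖x - y‖ ≠ 0 := norm_ne_zero_iff.2 (sub_ne_zero.2 hx)
      have hc : ContinuousAt (fun s => Real.exp (-a * s) / s ^ 3) ‖x - y‖ :=
        ContinuousAt.div (by fun_prop) (by fun_prop) (pow_ne_zero 3 hr)
      have h1 := hc.tendsto.comp (tendsto_softDist y x)
      have h2 : Tendsto (fun ε : ℝ => ε ^ 2) (𝓝[>] 0) (𝓝 0) := by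
        have := (continuous_pow 2 (M := ℝ)).tendsto 0
        rw [zero_pow two_ne_zero] at this
        exact this.mono_left nhdsWithin_le_nhds
      simpa using h2.mul h1) hφ.continuous hφ.2
  have hD := tendsto_integral_approx_dirac ha y hφ.continuous hφ.2
  have hR := (((hy.const_mul (a ^ 2)).sub (hE.const_mul (a ^ 2))).sub hD)
  simp only [zero_mul, integral_zero, mul_zero, sub_zero] at hR
  refine tendsto_nhds_unique hL (hR.congr' ?_)
  filter_upwards [self_mem_nhdsWithin] with ε hε
  have hε' : (0 : ℝ) < ε := hε
  set s := softDist ε y with hs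
  have hs0 : ∀ x, s x ≠ 0 := fun x => (softDist_pos hε y x).ne'
  set κ : E3 → ℝ := fun x => -(a ^ 2 * Real.exp (-a * s x) / s x ^ 3
    + 3 * ((1 + a * s x) * Real.exp (-a * s x)) / s x ^ 5) with hκ
  have hκc : Continuous κ := by
    refine Continuous.neg (Continuous.add ?_ ?_)
    · exact Continuous.div (by fun_prop) (by fun_prop) fun x => pow_ne_zero 3 (hs0 x)
    · exact Continuous.div (by fun_prop) (by fun_prop) fun x => pow_ne_zero 5 (hs0 x)
  have hdiv : ∀ i : Fin 3, ∫ x, yukawaSlope a (s x) * (x - y) i * fderiv ℝ φ x (unitVec i)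
      = -∫ x, (yukawaSlope a (s x) + κ x * (x - y) i ^ 2) * φ x := fun i => by
    have hfd : ∀ x, HasFDerivAt (fun z => yukawaSlope a (s z) * (z - y) i)
        (yukawaSlope a (s x) • (EuclideanSpace.proj i : E3 →L[ℝ] ℝ)
          + (x - y) i • κ x • innerSL ℝ (x - y)) x := fun x => by
      have h1 := hasFDerivAt_comp_softDist hε (hasDerivAt_yukawaSlope a (hs0 x))
      rw [mul_div_cancel_right₀ _ (hs0 x)] at h1
      have h2 : HasFDerivAt (fun z : E3 => (z - y) i) (EuclideanSpace.proj i : E3 →L[ℝ] ℝ) x :=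
        (EuclideanSpace.proj i : E3 →L[ℝ] ℝ).hasFDerivAt.comp x ((hasFDerivAt_id x).sub_const y)
      exact h1.mul h2
    have hap : ∀ x, (yukawaSlope a (s x) • (EuclideanSpace.proj i : E3 →L[ℝ] ℝ)
        + (x - y) i • κ x • innerSL ℝ (x - y)) (unitVec i)
        = yukawaSlope a (s x) + κ x * (x - y) i ^ 2 := fun x => by
      simp only [add_apply, smul_apply, innerSL_apply_apply, inner_unitVec]
      simp [unitVec]
      ring
    refine (integral_mul_fderiv_eq_neg (f := fun x => yukawaSlope a (s x) * (x - y) i)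
      ((hcs ε hε).mul (by fun_prop)) hfd ?_ hφ).trans (by simp only [hap])
    simp only [hap]
    exact (hcs ε hε).add (hκc.mul (by fun_prop))
  rw [Finset.sum_congr rfl fun i _ => hdiv i]
  have hint : ∀ {F : E3 → ℝ}, Continuous F → Integrable fun x => F x * φ x := fun hF =>
    (hF.mul hφ.continuous).integrable_of_hasCompactSupport hφ.2.mul_left
  have hcd : Continuous fun x => 3 * ε ^ 2 * ((1 + a * s x) * Real.exp (-a * s x)) / s x ^ 5 :=
    Continuous.div (by fun_prop) (by fun_prop) fun x => pow_ne_zero 5 (hs0 x)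
  have hsumint : ∀ i ∈ (Finset.univ : Finset (Fin 3)), Integrable fun x =>
      (yukawaSlope a (s x) + κ x * (x - y) i ^ 2) * φ x := fun i _ =>
    hint ((hcs ε hε).add (hκc.mul (by fun_prop)))
  have hdiff : Integrable fun x => a ^ 2 * (yukawa a (s x) * φ x)
      - a ^ 2 * (ε ^ 2 * (Real.exp (-a * s x) / s x ^ 3) * φ x) :=
    ((hint (hcy ε hε)).const_mul _).sub ((hint (hcE ε hε)).const_mul _)
  rw [Finset.sum_neg_distrib, ← integral_finsetSum _ hsumint, ← integral_const_mul, ← integral_const_mul,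
    ← integral_sub ((hint (hcy ε hε)).const_mul _) ((hint (hcE ε hε)).const_mul _),
    ← integral_sub hdiff (hint hcd), ← integral_neg]
  refine integral_congr_ae (Eventually.of_forall fun x => ?_)
  have hsum : ∑ i, (x - y) i ^ 2 = s x ^ 2 - ε ^ 2 := by
    rw [hs, softDist_sq, EuclideanSpace.real_norm_sq_eq]; ring
  have hsum' : ∑ i : Fin 3, (yukawaSlope a (s x) + κ x * (x - y) i ^ 2) * φ x
      = (3 * yukawaSlope a (s x) + κ x * (s x ^ 2 - ε ^ 2)) * φ x := by
    rw [← Finset.sum_mul, Finset.sum_add_distrib, ← Finset.mul_sum, hsum]; simp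
  refine Eq.trans ?_ (congrArg Neg.neg hsum'.symm)
  simp only [hκ, yukawa, yukawaSlope]
  have := hs0 x
  field_simp
  ring

lemma greenFun_eq_yukawa (lam : ℝ) (y x : E3) :
    greenFun lam y x = (4 * Real.pi)⁻¹ * yukawa (√lam) ‖x - y‖ := by
  unfold greenFun yukawa
  rw [div_mul_eq_div_div, div_right_comm, div_eq_inv_mul]

@[fun_prop]
lemma measurable_greenFun (lam : ℝ) (y : E3) : Measurable (greenFun lam y) := by
  unfold greenFun; fun_prop

lemma integrable_greenFun_mul (lam : ℝ) (y : E3) {φ : E3 → ℝ} (hφ : IsTest φ) :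
    Integrable fun x => greenFun lam y x * φ x := by
  refine integrable_mul_of_norm_le_norm_sub_inv_pow (y := y) (k := 1) (by norm_num)
    (C := (4 * Real.pi)⁻¹) (measurable_greenFun lam y).aestronglyMeasurable (fun x hx => ?_)
    hφ.continuous hφ.2
  have hr : 0 < ‖x - y‖ := norm_pos_iff.2 (sub_ne_zero.2 hx)
  have hy := yukawa_nonneg √lam hr.le
  rw [greenFun_eq_yukawa, Real.norm_of_nonneg (by positivity), pow_one]
  exact mul_le_mul_of_nonneg_left (yukawa_le_inv (Real.sqrt_nonneg _) hr le_rfl) (by positivity)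

/-- `greenFun lam y` is a fundamental solution: `(-Δ + lam) (greenFun lam y) = δ_y`. -/
lemma integral_greenFun_mul_laplacian {lam : ℝ} (hlam : 0 ≤ lam) (y : E3) {φ : E3 → ℝ}
    (hφ : IsTest φ) :
    ∫ x, greenFun lam y x * Laplacian.laplacian φ x
      = lam * (∫ x, greenFun lam y x * φ x) - φ y := by
  have h1 : ∀ i : Fin 3, ∫ x, yukawa (√lam) ‖x - y‖
      * fderiv ℝ (fun z => fderiv ℝ φ z (unitVec i)) x (unitVec i)
      = ∫ x, yukawaSlope (√lam) ‖x - y‖ * (x - y) i * fderiv ℝ φ x (unitVec i) := fun i =>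
    integral_yukawa_mul_fderiv (Real.sqrt_nonneg _) y i (hφ.fderiv_apply (unitVec i))
  have h2 := sum_integral_yukawaSlope_mul_fderiv (Real.sqrt_nonneg lam) y hφ
  have hi : ∀ i : Fin 3, Integrable fun x => greenFun lam y x
      * fderiv ℝ (fun z => fderiv ℝ φ z (unitVec i)) x (unitVec i) := fun i =>
    integrable_greenFun_mul lam y ((hφ.fderiv_apply (unitVec i)).fderiv_apply (unitVec i))
  simp only [laplacian_eq_sum_fderiv hφ.1, Finset.mul_sum]
  rw [integral_finsetSum _ fun i _ => hi i]
  simp only [greenFun_eq_yukawa, mul_assoc, integral_const_mul] at h1 h2 ⊢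
  simp only [h1, ← Finset.mul_sum]
  rw [h2, Real.sq_sqrt hlam]
  field_simp

end Delta

/-! ### Calculus of distributional derivatives -/

section WeakDerivatives

lemma integrable_mul_of_isTest {u φ : E3 → ℝ} (hu : LocallyIntegrable u) (hφ : IsTest φ) :
    Integrable fun x => u x * φ x :=
  hu.integrable_smul_right_of_hasCompactSupport hφ.continuous hφ.2

lemma locallyIntegrable_coe (g : L2) : LocallyIntegrable (g : E3 → ℝ) :=
  (Lp.memLp g).locallyIntegrable (by norm_num)

lemma HasWeakPartial.add_const_mul {i : Fin 3} {u v g h : E3 → ℝ} (hu : HasWeakPartial i u g)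
    (hv : HasWeakPartial i v h) (hul : LocallyIntegrable u) (hvl : LocallyIntegrable v)
    (hgl : LocallyIntegrable g) (hhl : LocallyIntegrable h) (c : ℝ) :
    HasWeakPartial i (fun x => u x + c * v x) fun x => g x + c * h x := fun φ hφ => by
  have h1 := integrable_mul_of_isTest hul (hφ.fderiv_apply (unitVec i))
  have h2 := (integrable_mul_of_isTest hvl (hφ.fderiv_apply (unitVec i))).const_mul c
  have h3 := integrable_mul_of_isTest hgl hφ
  have h4 := (integrable_mul_of_isTest hhl hφ).const_mul c
  simp only [add_mul, mul_assoc]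
  rw [integral_add h1 h2, integral_add h3 h4, integral_const_mul, integral_const_mul, hu φ hφ,
    hv φ hφ]
  ring

lemma HasWeakLaplacian.add_const_mul {u v g h : E3 → ℝ} (hu : HasWeakLaplacian u g)
    (hv : HasWeakLaplacian v h) (hul : LocallyIntegrable u) (hvl : LocallyIntegrable v)
    (hgl : LocallyIntegrable g) (hhl : LocallyIntegrable h) (c : ℝ) :
    HasWeakLaplacian (fun x => u x + c * v x) fun x => g x + c * h x := fun φ hφ => by
  have h1 := integrable_mul_of_isTest hul hφ.laplacian
  have h2 := (integrable_mul_of_isTest hvl hφ.laplacian).const_mul c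
  have h3 := integrable_mul_of_isTest hgl hφ
  have h4 := (integrable_mul_of_isTest hhl hφ).const_mul c
  simp only [add_mul, mul_assoc]
  rw [integral_add h1 h2, integral_add h3 h4, integral_const_mul, integral_const_mul, hu φ hφ,
    hv φ hφ]

lemma integral_mul_congr_ae {u v : E3 → ℝ} (huv : u =ᵐ[volume] v) (φ : E3 → ℝ) :
    ∫ x, u x * φ x = ∫ x, v x * φ x :=
  integral_congr_ae (huv.mul (ae_eq_refl φ))

lemma HasWeakPartial.congr_ae {i : Fin 3} {u v g h : E3 → ℝ} (hu : HasWeakPartial i u g)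
    (huv : u =ᵐ[volume] v) (hgh : g =ᵐ[volume] h) : HasWeakPartial i v h := fun φ hφ => by
  rw [← integral_mul_congr_ae huv, ← integral_mul_congr_ae hgh]
  exact hu φ hφ

lemma HasWeakLaplacian.congr_ae {u v g h : E3 → ℝ} (hu : HasWeakLaplacian u g)
    (huv : u =ᵐ[volume] v) (hgh : g =ᵐ[volume] h) : HasWeakLaplacian v h := fun φ hφ => by
  rw [← integral_mul_congr_ae huv, ← integral_mul_congr_ae hgh]
  exact hu φ hφ

lemma coeFn_add_smul (g h : L2) (c : ℝ) :
    (fun x => g x + c * h x) =ᵐ[volume] ((g + c • h : L2) : E3 → ℝ) := by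
  filter_upwards [Lp.coeFn_add g (c • h), Lp.coeFn_smul c h] with x h1 h2
  rw [h1, Pi.add_apply, h2, Pi.smul_apply, smul_eq_mul]

lemma HasWeakLaplacian.coe_add_smul {u v : E3 → ℝ} {g h : L2} (hu : HasWeakLaplacian u g)
    (hv : HasWeakLaplacian v h) (hul : LocallyIntegrable u) (hvl : LocallyIntegrable v) (c : ℝ) :
    HasWeakLaplacian (fun x => u x + c * v x) ((g + c • h : L2) : E3 → ℝ) :=
  (hu.add_const_mul hv hul hvl (locallyIntegrable_coe g) (locallyIntegrable_coe h) c).congr_ae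
    (ae_eq_refl _) (coeFn_add_smul g h c)

/-- The distributional Laplacian is unique. -/
lemma HasWeakLaplacian.unique {u : E3 → ℝ} {g h : L2} (hg : HasWeakLaplacian u g)
    (hh : HasWeakLaplacian u h) : g = h := by
  refine Lp.ext (ae_eq_of_integral_contDiff_smul_eq (locallyIntegrable_coe g)
    (locallyIntegrable_coe h) fun φ hφ hφs => ?_)
  have := (hg φ ⟨hφ, hφs⟩).symm.trans (hh φ ⟨hφ, hφs⟩)
  simpa [mul_comm] using this

lemma Htilde2.locallyIntegrable {u : E3 → ℝ} (hu : u ∈ Htilde2) : LocallyIntegrable u :=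
  hu.1.locallyIntegrable

lemma Htilde2.add_const_mul {u v : E3 → ℝ} (hu : u ∈ Htilde2) (hv : v ∈ Htilde2) (c : ℝ) :
    (fun x => u x + c * v x) ∈ Htilde2 := by
  have hul := Htilde2.locallyIntegrable hu
  have hvl := Htilde2.locallyIntegrable hv
  obtain ⟨huc, ⟨C, hC⟩, hu1, f, hf⟩ := hu
  obtain ⟨hvc, ⟨D, hD⟩, hv1, f', hf'⟩ := hv
  refine ⟨by fun_prop, ⟨C + |c| * D, fun x => ?_⟩, fun i => ?_,
    f + c • f', hf.coe_add_smul hf' hul hvl c⟩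
  · refine (abs_add_le _ _).trans (add_le_add (hC x) ?_)
    rw [abs_mul]
    exact mul_le_mul_of_nonneg_left (hD x) (abs_nonneg c)
  · obtain ⟨g, hg⟩ := hu1 i
    obtain ⟨h, hh⟩ := hv1 i
    exact ⟨g + c • h, (hg.add_const_mul hh hul hvl (locallyIntegrable_coe g)
      (locallyIntegrable_coe h) c).congr_ae (ae_eq_refl _) (coeFn_add_smul g h c)⟩

end WeakDerivatives

/-! ### The regular part of the Green function -/

section RegularPart

/-- The continuous function on `ℝ³` that equals `greenFun lam y - greenFun 0 y` away from `y`. -/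
noncomputable def regKernel (lam : ℝ) (y x : E3) : ℝ :=
  (4 * Real.pi)⁻¹ * dslope (fun r => Real.exp (-√lam * r)) 0 ‖x - y‖

lemma hasDerivAt_exp_neg_mul_zero (a : ℝ) :
    HasDerivAt (fun r => Real.exp (-a * r)) (-a) 0 := by
  simpa using hasDerivAt_exp_neg_mul a 0

lemma regKernel_of_ne (lam : ℝ) {y x : E3} (h : x ≠ y) :
    regKernel lam y x = greenFun lam y x - greenFun 0 y x := by
  have hr : ‖x - y‖ ≠ 0 := norm_ne_zero_iff.2 (sub_ne_zero.2 h)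
  rw [regKernel, dslope_of_ne _ hr, slope_def_field, greenFun, greenFun]
  simp only [Real.sqrt_zero, neg_zero, zero_mul, mul_zero, Real.exp_zero, sub_zero]
  field_simp

lemma regKernel_self (lam : ℝ) (y : E3) : regKernel lam y y = -√lam / (4 * Real.pi) := by
  rw [regKernel, sub_self, norm_zero, dslope_same, (hasDerivAt_exp_neg_mul_zero _).deriv]
  field_simp

lemma continuous_regKernel (lam : ℝ) (y : E3) : Continuous (regKernel lam y) := by
  have h : Continuous (dslope (fun r => Real.exp (-√lam * r)) 0) := by
    rw [← continuousOn_univ, continuousOn_dslope univ_mem]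
    exact ⟨by fun_prop, (hasDerivAt_exp_neg_mul_zero _).differentiableAt⟩
  unfold regKernel
  fun_prop

lemma abs_regKernel_le (lam : ℝ) (y x : E3) : |regKernel lam y x| ≤ (4 * Real.pi)⁻¹ * √lam := by
  rw [regKernel, abs_mul, abs_of_pos (by positivity : 0 < (4 * Real.pi)⁻¹)]
  refine mul_le_mul_of_nonneg_left ?_ (by positivity)
  have hs := Real.sqrt_nonneg lam
  rcases (norm_nonneg (x - y)).eq_or_lt with h0 | hr
  · rw [← h0, dslope_same, (hasDerivAt_exp_neg_mul_zero _).deriv, abs_neg, abs_of_nonneg hs]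
  · rw [dslope_of_ne _ hr.ne', slope_def_field, sub_zero, mul_zero, Real.exp_zero, abs_div,
      abs_of_pos hr, div_le_iff₀ hr, abs_sub_comm, abs_of_nonneg]
    · have := Real.add_one_le_exp (-√lam * ‖x - y‖)
      linarith
    · have : Real.exp (-√lam * ‖x - y‖) ≤ 1 := Real.exp_le_one_iff.2 (by nlinarith)
      linarith

lemma regKernel_ae_eq (lam : ℝ) (y : E3) :
    (fun x => greenFun lam y x - greenFun 0 y x) =ᵐ[volume] regKernel lam y := by
  have : ∀ᵐ x : E3, x ≠ y := by simp [ae_iff]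
  filter_upwards [this] with x hx using (regKernel_of_ne lam hx).symm

lemma memLp_inv_one_add_norm_sub_sq (y : E3) :
    MemLp (fun x : E3 => (1 + ‖x - y‖ ^ 2)⁻¹) 2 volume := by
  have h0 : MemLp (fun x : E3 => (1 + ‖x‖ ^ 2)⁻¹) 2 volume := by
    rw [memLp_two_iff_integrable_sq (Measurable.aestronglyMeasurable (by fun_prop))]
    have := integrable_rpow_neg_one_add_norm_sq (E := E3) (μ := volume) (r := 4)
      (by simp; norm_num)
    refine this.congr (Eventually.of_forall fun x => ?_)
    simp only
    rw [show (-4 / 2 : ℝ) = -(2 : ℕ) by norm_num, Real.rpow_neg (by positivity),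
      Real.rpow_natCast, inv_pow]
  exact h0.comp_measurePreserving (measurePreserving_sub_right volume y)

/-- The `i`-th partial derivative of `regKernel lam y` away from `y`; its value at `y` is `0`. -/
noncomputable def regKernelPartial (lam : ℝ) (y : E3) (i : Fin 3) (x : E3) : ℝ :=
  (4 * Real.pi)⁻¹ * ((yukawaSlope 0 ‖x - y‖ - yukawaSlope (√lam) ‖x - y‖) * (x - y) i)

lemma abs_regKernelPartial_le (lam : ℝ) (y : E3) (i : Fin 3) (x : E3) :
    |regKernelPartial lam y i x| ≤ (4 * Real.pi)⁻¹ * (1 + √lam ^ 2) * (1 + ‖x - y‖ ^ 2)⁻¹ := by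
  rw [regKernelPartial, abs_mul, abs_of_pos (by positivity : 0 < (4 * Real.pi)⁻¹), mul_assoc]
  refine mul_le_mul_of_nonneg_left ?_ (by positivity)
  rcases eq_or_ne x y with rfl | hne
  · simp; positivity
  have hr : 0 < ‖x - y‖ := norm_pos_iff.2 (sub_ne_zero.2 hne)
  have hi := abs_sub_apply_le x y i
  set r := ‖x - y‖
  set a := √lam
  have ha : 0 ≤ a := Real.sqrt_nonneg lam
  set m := (1 + a * r) * Real.exp (-a * r) with hm
  have hm0 : 0 ≤ m := by positivity
  have hm1 : m ≤ 1 := by rw [hm, neg_mul]; exact one_add_mul_exp_neg_le_one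
  have hm2 : 1 - m ≤ (a * r) ^ 2 := by
    have := Real.add_one_le_exp (-a * r)
    have h3 : (1 + a * r) * (-a * r + 1) ≤ m := mul_le_mul_of_nonneg_left this (by positivity)
    nlinarith
  have he : yukawaSlope 0 r - yukawaSlope a r = (1 - m) / r ^ 3 := by
    simp only [yukawaSlope, hm, neg_zero, zero_mul, add_zero, Real.exp_zero, mul_one, sub_div]
  rw [he, abs_mul, abs_of_nonneg (div_nonneg (by linarith) (by positivity)), ← div_eq_mul_inv,
    le_div_iff₀ (by positivity)]
  calc (1 - m) / r ^ 3 * |(x - y) i| * (1 + r ^ 2)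
      ≤ (1 - m) / r ^ 3 * r * (1 + r ^ 2) := by
        have : 0 ≤ (1 - m) / r ^ 3 := div_nonneg (by linarith) (by positivity)
        gcongr
    _ = (1 - m) / r ^ 2 + (1 - m) := by field_simp
    _ ≤ a ^ 2 + 1 := by
        refine add_le_add ?_ (by linarith)
        rw [div_le_iff₀ (by positivity)]
        nlinarith
    _ = 1 + a ^ 2 := add_comm _ _

lemma memLp_regKernelPartial (lam : ℝ) (y : E3) (i : Fin 3) :
    MemLp (regKernelPartial lam y i) 2 volume := by
  refine ((memLp_inv_one_add_norm_sub_sq y).const_mul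
    ((4 * Real.pi)⁻¹ * (1 + √lam ^ 2))).mono ?_ (Eventually.of_forall fun x => ?_)
  · unfold regKernelPartial yukawaSlope
    exact Measurable.aestronglyMeasurable (by fun_prop)
  · refine (abs_regKernelPartial_le lam y i x).trans (le_abs_self _)

lemma locallyIntegrable_regKernel (lam : ℝ) (y : E3) : LocallyIntegrable (regKernel lam y) :=
  (continuous_regKernel lam y).locallyIntegrable

lemma integrable_yukawaSlope_mul {a : ℝ} (ha : 0 ≤ a) (y : E3) (i : Fin 3) {φ : E3 → ℝ}
    (hφ : IsTest φ) : Integrable fun x => yukawaSlope a ‖x - y‖ * (x - y) i * φ x := by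
  refine integrable_mul_of_norm_le_norm_sub_inv_pow (y := y) (k := 2) le_rfl (C := 1)
    (by unfold yukawaSlope; exact Measurable.aestronglyMeasurable (by fun_prop)) (fun x hx => ?_)
    hφ.continuous hφ.2
  have hr : 0 < ‖x - y‖ := norm_pos_iff.2 (sub_ne_zero.2 hx)
  have hn := yukawaSlope_nonneg ha hr.le
  rw [one_mul, norm_mul, Real.norm_of_nonneg hn]
  exact (mul_le_mul_of_nonneg_left (abs_sub_apply_le x y i) hn).trans
    (yukawaSlope_mul_le_inv_sq hr le_rfl)

lemma hasWeakPartial_regKernel (lam : ℝ) (y : E3) (i : Fin 3) :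
    HasWeakPartial i (regKernel lam y) (regKernelPartial lam y i) := fun φ hφ => by
  have hd := hφ.fderiv_apply (unitVec i)
  rw [← integral_mul_congr_ae (regKernel_ae_eq lam y)]
  simp only [sub_mul]
  rw [integral_sub (integrable_greenFun_mul lam y hd) (integrable_greenFun_mul 0 y hd)]
  simp only [greenFun_eq_yukawa, mul_assoc, integral_const_mul, Real.sqrt_zero, regKernelPartial]
  rw [integral_yukawa_mul_fderiv (Real.sqrt_nonneg _) y i hφ,
    integral_yukawa_mul_fderiv le_rfl y i hφ]
  have := integral_sub (integrable_yukawaSlope_mul le_rfl y i hφ)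
    (integrable_yukawaSlope_mul (Real.sqrt_nonneg lam) y i hφ)
  simp only [sub_mul, mul_assoc] at this ⊢
  rw [this]
  ring

lemma hasWeakLaplacian_regKernel {lam : ℝ} (hlam : 0 ≤ lam) (y : E3) :
    HasWeakLaplacian (regKernel lam y) fun x => lam * greenFun lam y x := fun φ hφ => by
  have hd := hφ.laplacian
  rw [← integral_mul_congr_ae (regKernel_ae_eq lam y)]
  simp only [sub_mul, mul_assoc]
  rw [integral_sub (integrable_greenFun_mul lam y hd) (integrable_greenFun_mul 0 y hd),
    integral_greenFun_mul_laplacian hlam y hφ, integral_greenFun_mul_laplacian le_rfl y hφ,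
    integral_const_mul]
  ring

/-- The element of `L²(ℝ³)` given by `greenFun lam y`. -/
noncomputable def greenL2 {lam : ℝ} (hlam : 0 < lam) (y : E3) : L2 :=
  (memLp_greenFun hlam y).toLp (greenFun lam y)

lemma coeFn_greenL2 {lam : ℝ} (hlam : 0 < lam) (y : E3) :
    (greenL2 hlam y : E3 → ℝ) =ᵐ[volume] greenFun lam y :=
  MemLp.coeFn_toLp _

lemma hasWeakLaplacian_regKernel_coe {lam : ℝ} (hlam : 0 < lam) (y : E3) :
    HasWeakLaplacian (regKernel lam y) ((lam • greenL2 hlam y : L2) : E3 → ℝ) := by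
  refine (hasWeakLaplacian_regKernel hlam.le y).congr_ae (ae_eq_refl _) ?_
  filter_upwards [Lp.coeFn_smul lam (greenL2 hlam y), coeFn_greenL2 hlam y] with x h1 h2
  rw [h1, Pi.smul_apply, h2, smul_eq_mul]

lemma regKernel_mem_Htilde2 {lam : ℝ} (hlam : 0 < lam) (y : E3) : regKernel lam y ∈ Htilde2 :=
  ⟨continuous_regKernel lam y, ⟨_, abs_regKernel_le lam y⟩,
    fun i => ⟨(memLp_regKernelPartial lam y i).toLp _, (hasWeakPartial_regKernel lam y i).congr_ae
      (ae_eq_refl _) (MemLp.coeFn_toLp _).symm⟩, _, hasWeakLaplacian_regKernel_coe hlam y⟩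

end RegularPart

/-! ### The resolvent of the Laplacian on Schwartz functions -/

section SchwartzResolvent

open scoped SchwartzMap LineDeriv Laplacian

lemma hasTemperateGrowth_inv_add_norm_sq {lam : ℝ} (hlam : 0 < lam) :
    (fun x : E3 => (lam + (2 * Real.pi) ^ 2 * ‖x‖ ^ 2)⁻¹).HasTemperateGrowth := by
  have h1 : ((fun x : E3 => (1 + ‖x‖ ^ 2) ^ (-1 : ℝ)) ∘
      fun x : E3 => (2 * Real.pi / √lam) • x).HasTemperateGrowth :=
    (Function.hasTemperateGrowth_one_add_norm_sq_rpow E3 (-1)).comp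
      ((2 * Real.pi / √lam) • ContinuousLinearMap.id ℝ E3).hasTemperateGrowth
  have h2 := (Function.HasTemperateGrowth.const (E := E3) lam⁻¹).mul h1
  convert! h2 using 1
  ext x
  have hs : √lam ^ 2 = lam := Real.sq_sqrt hlam.le
  have hs0 : 0 < √lam := Real.sqrt_pos.2 hlam
  simp only [Pi.mul_apply, Function.comp_apply, norm_smul, Real.norm_eq_abs, mul_pow, sq_abs,
    Real.rpow_neg_one, div_pow, hs]
  rw [← mul_inv]
  congr 1
  field_simp

lemma laplacian_postcompCLM {F G : Type*} [NormedAddCommGroup F] [NormedSpace ℝ F]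
    [NormedAddCommGroup G] [NormedSpace ℝ G] (L : F →L[ℝ] G) (f : 𝓢(E3, F)) :
    Δ (f.postcompCLM L) = (Δ f).postcompCLM L := by
  ext x
  rw [SchwartzMap.laplacian_apply, SchwartzMap.postcompCLM_apply, SchwartzMap.laplacian_apply]
  exact ((f.smooth 2).contDiffAt (x := x)).laplacian_CLM_comp_left (l := L)

/-- On Schwartz functions the resolvent is the Fourier multiplier `(lam + 4π² ‖k‖²)⁻¹`. -/
lemma exists_smul_sub_laplacian_eq {lam : ℝ} (hlam : 0 < lam) (ψ : 𝓢(E3, ℝ)) :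
    ∃ φ : 𝓢(E3, ℝ), lam • φ - Δ φ = ψ := by
  set g : E3 → ℝ := fun x => (lam + (2 * Real.pi) ^ 2 * ‖x‖ ^ 2)⁻¹ with hg_def
  have hg : g.HasTemperateGrowth := hasTemperateGrowth_inv_add_norm_sq hlam
  have hn : (fun x : E3 => ‖x‖ ^ 2).HasTemperateGrowth := Function.hasTemperateGrowth_norm_sq E3
  set Ψ : 𝓢(E3, ℂ) := ψ.postcompCLM Complex.ofRealCLM
  set Φ : 𝓢(E3, ℂ) := SchwartzMap.fourierMultiplierCLM ℂ g Ψ with hΦ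
  have key : lam • Φ - Δ Φ = Ψ := by
    have h1 : lam • Φ = SchwartzMap.fourierMultiplierCLM ℂ (lam • g) Ψ := by
      rw [SchwartzMap.fourierMultiplierCLM_smul hg]; rfl
    have h2 : Δ Φ = -SchwartzMap.fourierMultiplierCLM ℂ
        ((2 * Real.pi) ^ 2 • ((fun x : E3 => ‖x‖ ^ 2) * g)) Ψ := by
      rw [SchwartzMap.laplacian_eq_fourierMultiplierCLM, hΦ,
        SchwartzMap.fourierMultiplierCLM_smul (hn.mul hg)]
      erw [SchwartzMap.fourierMultiplierCLM_fourierMultiplierCLM_apply hn hg]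
      simp [neg_smul]
    have h3 : SchwartzMap.fourierMultiplierCLM ℂ (fun _ : E3 => (1 : ℝ)) Ψ = Ψ := by
      simp
    rw [h1, h2, sub_neg_eq_add]
    refine Eq.trans ?_ h3
    simp only [SchwartzMap.fourierMultiplierCLM_apply]
    have e1 : lam • g = (fun _ => lam) * g := rfl
    have e2 : (2 * Real.pi) ^ 2 • ((fun x : E3 => ‖x‖ ^ 2) * g)
        = (fun _ => (2 * Real.pi) ^ 2) * ((fun x : E3 => ‖x‖ ^ 2) * g) := rfl
    rw [← FourierTransform.fourierInv_add, ← add_apply, e1, e2,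
      ← SchwartzMap.smulLeftCLM_add ((Function.HasTemperateGrowth.const lam).mul hg)
        ((Function.HasTemperateGrowth.const _).mul (hn.mul hg))]
    congr 3
    ext x
    have : lam + (2 * Real.pi) ^ 2 * ‖x‖ ^ 2 ≠ 0 := by positivity
    simp only [hg_def, Pi.add_apply, Pi.mul_apply]
    field_simp
  refine ⟨Φ.postcompCLM Complex.reCLM, ?_⟩
  rw [laplacian_postcompCLM, ← map_smul, ← map_sub, key]
  ext x
  simp [Ψ]

/-- A real Schwartz function as an element of `L²(ℝ³)`. -/
noncomputable abbrev schwartzL2 (φ : 𝓢(E3, ℝ)) : L2 := φ.toLp 2 volume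

lemma coeFn_schwartzL2 (φ : 𝓢(E3, ℝ)) : (schwartzL2 φ : E3 → ℝ) =ᵐ[volume] φ :=
  SchwartzMap.coeFn_toLp φ 2 volume

lemma schwartzL2_sub (φ ψ : 𝓢(E3, ℝ)) : schwartzL2 (φ - ψ) = schwartzL2 φ - schwartzL2 ψ :=
  map_sub (SchwartzMap.toLpCLM ℝ ℝ 2 (volume : Measure E3)) φ ψ

lemma schwartzL2_smul (c : ℝ) (φ : 𝓢(E3, ℝ)) : schwartzL2 (c • φ) = c • schwartzL2 φ :=
  map_smul (SchwartzMap.toLpCLM ℝ ℝ 2 (volume : Measure E3)) c φ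

lemma inner_eq_integral (u v : L2) : inner ℝ u v = ∫ x, u x * v x := by
  rw [L2.inner_def]
  simp [mul_comm]

lemma inner_schwartzL2 (u : L2) (φ : 𝓢(E3, ℝ)) : inner ℝ u (schwartzL2 φ) = ∫ x, u x * φ x := by
  rw [inner_eq_integral]
  exact integral_congr_ae ((ae_eq_refl _).mul (coeFn_schwartzL2 φ))

lemma inner_schwartzL2_schwartzL2 (φ ψ : 𝓢(E3, ℝ)) :
    inner ℝ (schwartzL2 φ) (schwartzL2 ψ) = ∫ x, φ x * ψ x := by
  rw [inner_schwartzL2]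
  exact integral_congr_ae ((coeFn_schwartzL2 φ).mul (ae_eq_refl _))

lemma inner_lineDerivOp_right (φ ψ : 𝓢(E3, ℝ)) (v : E3) :
    inner ℝ (schwartzL2 φ) (schwartzL2 (∂_{v} ψ))
      = -inner ℝ (schwartzL2 (∂_{v} φ)) (schwartzL2 ψ) := by
  rw [inner_schwartzL2_schwartzL2, inner_schwartzL2_schwartzL2]
  exact SchwartzMap.integral_mul_lineDerivOp_right_eq_neg_left φ ψ v

lemma schwartz_laplacian_eq_sum (φ : 𝓢(E3, ℝ)) :
    Δ φ = ∑ i, ∂_{unitVec i} (∂_{unitVec i} φ) := by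
  rw [SchwartzMap.laplacian_eq_sum (EuclideanSpace.basisFun (Fin 3) ℝ)]
  simp [unitVec]

lemma schwartz_lineDerivOp_comm (φ : 𝓢(E3, ℝ)) (v w : E3) :
    ∂_{v} (∂_{w} φ) = ∂_{w} (∂_{v} φ) := by
  ext x
  have h : ∀ v w : E3, (∂_{v} (∂_{w} φ) : 𝓢(E3, ℝ)) x = iteratedFDeriv ℝ 2 φ x ![v, w] :=
    fun v w => (iteratedFDeriv_two_eq_fderiv_fderiv (φ.smooth _) x v w).symm
  rw [h, h]
  have := ((φ.smooth 2).contDiffAt (x := x)).isSymmSndFDerivAt (by simp)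
  simpa [iteratedFDeriv_two_apply] using this v w

lemma schwartzL2_sum {ι : Type*} (s : Finset ι) (f : ι → 𝓢(E3, ℝ)) :
    schwartzL2 (∑ i ∈ s, f i) = ∑ i ∈ s, schwartzL2 (f i) :=
  map_sum (SchwartzMap.toLpCLM ℝ ℝ 2 (volume : Measure E3)) f s

lemma inner_schwartz_laplacian (φ : 𝓢(E3, ℝ)) :
    inner ℝ (schwartzL2 (Δ φ)) (schwartzL2 φ) = -∑ i, ‖schwartzL2 (∂_{unitVec i} φ)‖ ^ 2 := by
  rw [schwartz_laplacian_eq_sum, schwartzL2_sum, sum_inner, ← Finset.sum_neg_distrib]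
  refine Finset.sum_congr rfl fun i _ => ?_
  rw [real_inner_comm, inner_lineDerivOp_right, real_inner_self_eq_norm_sq]

/-- The `L²` norm of the Hessian equals that of the Laplacian, by two integrations by parts. -/
lemma norm_sq_schwartz_laplacian (φ : 𝓢(E3, ℝ)) :
    ‖schwartzL2 (Δ φ)‖ ^ 2 = ∑ i, ∑ j, ‖schwartzL2 (∂_{unitVec i} (∂_{unitVec j} φ))‖ ^ 2 := by
  rw [← real_inner_self_eq_norm_sq, schwartz_laplacian_eq_sum, schwartzL2_sum, sum_inner]
  refine Finset.sum_congr rfl fun i _ => ?_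
  rw [inner_sum]
  refine Finset.sum_congr rfl fun j _ => ?_
  rw [inner_lineDerivOp_right, schwartz_lineDerivOp_comm _ (unitVec j) (unitVec i), real_inner_comm,
    inner_lineDerivOp_right, neg_neg, schwartz_lineDerivOp_comm _ (unitVec j) (unitVec i),
    real_inner_self_eq_norm_sq]

lemma norm_schwartz_second_le (φ : 𝓢(E3, ℝ)) (i j : Fin 3) :
    ‖schwartzL2 (∂_{unitVec i} (∂_{unitVec j} φ))‖ ≤ ‖schwartzL2 (Δ φ)‖ := by
  refine le_of_sq_le_sq ?_ (norm_nonneg _)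
  rw [norm_sq_schwartz_laplacian]
  exact (Finset.single_le_sum (f := fun j =>
      ‖schwartzL2 (∂_{unitVec i} (∂_{unitVec j} φ))‖ ^ 2) (fun j _ => sq_nonneg _)
      (Finset.mem_univ j)).trans
    (Finset.single_le_sum (f := fun i => ∑ j,
      ‖schwartzL2 (∂_{unitVec i} (∂_{unitVec j} φ))‖ ^ 2)
      (fun i _ => Finset.sum_nonneg fun j _ => sq_nonneg _) (Finset.mem_univ i))

lemma inner_resolvent_schwartz (lam : ℝ) (φ : 𝓢(E3, ℝ)) :
    inner ℝ (schwartzL2 (lam • φ - Δ φ)) (schwartzL2 φ)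
      = lam * ‖schwartzL2 φ‖ ^ 2 + ∑ i, ‖schwartzL2 (∂_{unitVec i} φ)‖ ^ 2 := by
  rw [schwartzL2_sub, schwartzL2_smul, inner_sub_left, inner_smul_left, inner_schwartz_laplacian,
    real_inner_self_eq_norm_sq]
  simp

lemma norm_schwartz_le {lam : ℝ} (hlam : 0 < lam) (φ : 𝓢(E3, ℝ)) :
    ‖schwartzL2 φ‖ ≤ lam⁻¹ * ‖schwartzL2 (lam • φ - Δ φ)‖ := by
  have h1 := inner_resolvent_schwartz lam φ
  have h2 := real_inner_le_norm (schwartzL2 (lam • φ - Δ φ)) (schwartzL2 φ)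
  have h3 : 0 ≤ ∑ i, ‖schwartzL2 (∂_{unitVec i} φ)‖ ^ 2 :=
    Finset.sum_nonneg fun i _ => sq_nonneg _
  rw [inv_mul_eq_div, le_div_iff₀ hlam]
  rcases (norm_nonneg (schwartzL2 φ)).eq_or_lt with h0 | h0
  · rw [← h0, zero_mul]; exact norm_nonneg _
  · refine le_of_mul_le_mul_right ?_ h0
    nlinarith

lemma norm_schwartz_laplacian_le {lam : ℝ} (hlam : 0 < lam) (φ : 𝓢(E3, ℝ)) :
    ‖schwartzL2 (Δ φ)‖ ≤ 2 * ‖schwartzL2 (lam • φ - Δ φ)‖ := by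
  have h : schwartzL2 (Δ φ) = lam • schwartzL2 φ - schwartzL2 (lam • φ - Δ φ) := by
    rw [schwartzL2_sub, schwartzL2_smul, sub_sub_cancel]
  have h2 := norm_schwartz_le hlam φ
  rw [inv_mul_eq_div, le_div_iff₀ hlam] at h2
  rw [h]
  refine (norm_sub_le _ _).trans ?_
  rw [norm_smul, Real.norm_of_nonneg hlam.le]
  linarith

lemma norm_schwartz_lineDerivOp_le {lam : ℝ} (hlam : 0 < lam) (φ : 𝓢(E3, ℝ)) (i : Fin 3) :
    ‖schwartzL2 (∂_{unitVec i} φ)‖ ≤ √lam⁻¹ * ‖schwartzL2 (lam • φ - Δ φ)‖ := by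
  have h1 := inner_resolvent_schwartz lam φ
  have h2 := real_inner_le_norm (schwartzL2 (lam • φ - Δ φ)) (schwartzL2 φ)
  have h3 : ‖schwartzL2 (∂_{unitVec i} φ)‖ ^ 2 ≤ ∑ i, ‖schwartzL2 (∂_{unitVec i} φ)‖ ^ 2 :=
    Finset.single_le_sum (f := fun i => ‖schwartzL2 (∂_{unitVec i} φ)‖ ^ 2)
      (fun i _ => sq_nonneg _) (Finset.mem_univ i)
  have h4 := mul_le_mul_of_nonneg_left (norm_schwartz_le hlam φ)
    (norm_nonneg (schwartzL2 (lam • φ - Δ φ)))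
  refine le_of_sq_le_sq ?_ (by positivity)
  rw [mul_pow, Real.sq_sqrt (by positivity)]
  have h5 : 0 ≤ lam * ‖schwartzL2 φ‖ ^ 2 := by positivity
  linarith

end SchwartzResolvent

/-! ### Testing distributional Laplacians against Schwartz functions -/

section Cutoff

open scoped SchwartzMap LineDeriv Laplacian

/-- A smooth bump function on `ℝ³`, equal to `1` on the unit ball, as a Schwartz function. -/
noncomputable def bump : 𝓢(E3, ℝ) :=
  (ContDiffBump.hasCompactSupport (⟨1, 2, one_pos, one_lt_two⟩ : ContDiffBump (0 : E3))).toSchwartzMap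
    (ContDiffBump.contDiff _)

lemma bump_eq_one {x : E3} (hx : ‖x‖ ≤ 1) : bump x = 1 :=
  ContDiffBump.one_of_mem_closedBall _ (by simpa using hx)

lemma hasCompactSupport_bump : HasCompactSupport bump :=
  ContDiffBump.hasCompactSupport _

/-- Multiplication of Schwartz functions. -/
noncomputable def schwartzMul (φ ψ : 𝓢(E3, ℝ)) : 𝓢(E3, ℝ) :=
  SchwartzMap.pairing (ContinuousLinearMap.mul ℝ ℝ) φ ψ

lemma schwartzMul_apply (φ ψ : 𝓢(E3, ℝ)) (x : E3) : schwartzMul φ ψ x = φ x * ψ x := rfl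

lemma lineDerivOp_schwartzMul (φ ψ : 𝓢(E3, ℝ)) (v : E3) :
    ∂_{v} (schwartzMul φ ψ) = schwartzMul (∂_{v} φ) ψ + schwartzMul φ (∂_{v} ψ) := by
  ext x
  have : fderiv ℝ (fun z => φ z * ψ z) x v = _ :=
    congrArg (fun L => L v) (fderiv_fun_mul (φ.differentiableAt (x := x)) ψ.differentiableAt)
  refine this.trans ?_
  simp only [add_apply, smul_apply, smul_eq_mul, schwartzMul_apply,
    SchwartzMap.lineDerivOp_apply_eq_fderiv]
  ring

/-- The function `bump`, dilated by the factor `n + 1`. -/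
noncomputable def dilatedBump (n : ℕ) : 𝓢(E3, ℝ) :=
  SchwartzMap.compCLMOfContinuousLinearEquiv ℝ
    (ContinuousLinearEquiv.smulLeft (Units.mk0 ((n + 1 : ℝ)⁻¹) (by positivity))) bump

lemma dilatedBump_apply (n : ℕ) (x : E3) : dilatedBump n x = bump ((n + 1 : ℝ)⁻¹ • x) := rfl

lemma lineDerivOp_dilatedBump (n : ℕ) (v x : E3) :
    ∂_{v} (dilatedBump n) x = (n + 1 : ℝ)⁻¹ * (∂_{v} bump) ((n + 1 : ℝ)⁻¹ • x) := by
  rw [dilatedBump, SchwartzMap.lineDerivOp_compCLMOfContinuousLinearEquiv]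
  change (∂_{(n + 1 : ℝ)⁻¹ • v} bump : 𝓢(E3, ℝ)) ((n + 1 : ℝ)⁻¹ • x) = _
  rw [LineDeriv.lineDerivOp_left_smul]
  rfl

lemma lineDerivOp_lineDerivOp_dilatedBump (n : ℕ) (v x : E3) :
    ∂_{v} (∂_{v} (dilatedBump n)) x
      = (n + 1 : ℝ)⁻¹ ^ 2 * (∂_{v} (∂_{v} bump)) ((n + 1 : ℝ)⁻¹ • x) := by
  rw [dilatedBump, SchwartzMap.lineDerivOp_compCLMOfContinuousLinearEquiv]
  change (∂_{v} (SchwartzMap.compCLMOfContinuousLinearEquiv ℝ _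
    (∂_{(n + 1 : ℝ)⁻¹ • v} bump)) : 𝓢(E3, ℝ)) x = _
  rw [SchwartzMap.lineDerivOp_compCLMOfContinuousLinearEquiv]
  change (∂_{(n + 1 : ℝ)⁻¹ • v} (∂_{(n + 1 : ℝ)⁻¹ • v} bump) : 𝓢(E3, ℝ)) ((n + 1 : ℝ)⁻¹ • x) = _
  rw [LineDeriv.lineDerivOp_left_smul, LineDeriv.lineDerivOp_left_smul,
    LineDeriv.lineDerivOp_smul, smul_smul, sq]
  rfl

lemma isTest_dilatedBump_mul (n : ℕ) (φ : 𝓢(E3, ℝ)) : IsTest (schwartzMul (dilatedBump n) φ) := by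
  refine ⟨(schwartzMul (dilatedBump n) φ).smooth _, ?_⟩
  have : HasCompactSupport (dilatedBump n) :=
    hasCompactSupport_bump.comp_homeomorph
      (Homeomorph.smulOfNeZero ((n + 1 : ℝ)⁻¹) (by positivity : (n + 1 : ℝ)⁻¹ ≠ 0))
  exact this.mul_right

lemma eventually_dilatedBump_mul_eq (φ : 𝓢(E3, ℝ)) (x : E3) :
    ∀ᶠ n in atTop, (schwartzMul (dilatedBump n) φ : E3 → ℝ) =ᶠ[𝓝 x] φ := by
  obtain ⟨N, hN⟩ := exists_nat_gt (‖x‖ + 1)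
  filter_upwards [eventually_ge_atTop N] with n hn
  filter_upwards [Metric.ball_mem_nhds x one_pos] with z hz
  rw [schwartzMul_apply, dilatedBump_apply, bump_eq_one, one_mul]
  have h1 : ‖z‖ ≤ ‖x‖ + 1 := by
    have := norm_le_norm_add_norm_sub' z x
    rw [Metric.mem_ball, dist_eq_norm] at hz
    linarith
  have h2 : (N : ℝ) ≤ n := by exact_mod_cast hn
  rw [norm_smul, norm_inv, Real.norm_of_nonneg (by positivity), inv_mul_le_iff₀ (by positivity)]
  linarith

/-- The cut-off functions `dilatedBump n * φ` and their Laplacians are dominated, uniformly in `n`,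
by a square integrable function. -/
lemma exists_memLp_bound_dilatedBump_mul (φ : 𝓢(E3, ℝ)) :
    ∃ K : E3 → ℝ, MemLp K 2 volume ∧ ∀ n x, |schwartzMul (dilatedBump n) φ x| ≤ K x ∧
      |Δ (schwartzMul (dilatedBump n) φ) x| ≤ K x := by
  have hb : ∀ f : 𝓢(E3, ℝ), ∃ C, 0 ≤ C ∧ ∀ x, |f x| ≤ C := fun f =>
    ⟨_, apply_nonneg (SchwartzMap.seminorm ℝ 0 0) f, fun x => SchwartzMap.norm_le_seminorm ℝ f x⟩
  obtain ⟨C₀, hC₀, h₀⟩ := hb bump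
  choose C₁ hC₁ h₁ using fun i : Fin 3 => hb (∂_{unitVec i} bump)
  choose C₂ hC₂ h₂ using fun i : Fin 3 => hb (∂_{unitVec i} (∂_{unitVec i} bump))
  have hc0 : ∀ n : ℕ, 0 ≤ (n + 1 : ℝ)⁻¹ := fun n => by positivity
  have hc1 : ∀ n : ℕ, (n + 1 : ℝ)⁻¹ ≤ 1 := fun n => inv_le_one_of_one_le₀ (by simp)
  have b0 : ∀ n x, |dilatedBump n x| ≤ C₀ := fun n x => h₀ _
  have b1 : ∀ n i x, |∂_{unitVec i} (dilatedBump n) x| ≤ C₁ i := fun n i x => by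
    rw [lineDerivOp_dilatedBump, abs_mul, abs_of_nonneg (hc0 n)]
    exact (mul_le_of_le_one_left (abs_nonneg _) (hc1 n)).trans (h₁ i _)
  have b2 : ∀ n i x, |∂_{unitVec i} (∂_{unitVec i} (dilatedBump n)) x| ≤ C₂ i := fun n i x => by
    rw [lineDerivOp_lineDerivOp_dilatedBump, abs_mul, abs_of_nonneg (sq_nonneg _)]
    exact (mul_le_of_le_one_left (abs_nonneg _) (pow_le_one₀ (hc0 n) (hc1 n))).trans (h₂ i _)
  refine ⟨fun x => C₀ * ‖φ x‖ + ∑ i, (C₂ i * ‖φ x‖ + 2 * (C₁ i * ‖∂_{unitVec i} φ x‖)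
    + C₀ * ‖∂_{unitVec i} (∂_{unitVec i} φ) x‖), ?_, fun n x => ⟨?_, ?_⟩⟩
  · have hm : ∀ (f : 𝓢(E3, ℝ)) (c : ℝ), MemLp (fun x => c * ‖f x‖) 2 volume := fun f c =>
      (f.memLp 2 volume).norm.const_mul c
    exact (hm φ C₀).add (memLp_finsetSum _ fun i _ => ((hm φ _).add ((hm _ _).const_mul 2)).add
      (hm _ _))
  · have hn : 0 ≤ ∑ i, (C₂ i * ‖φ x‖ + 2 * (C₁ i * ‖∂_{unitVec i} φ x‖)
        + C₀ * ‖∂_{unitVec i} (∂_{unitVec i} φ) x‖) := Finset.sum_nonneg fun i _ => by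
      have := hC₁ i
      have := hC₂ i
      positivity
    refine le_add_of_le_of_nonneg ?_ hn
    rw [schwartzMul_apply, abs_mul]
    exact mul_le_mul_of_nonneg_right (b0 n x) (abs_nonneg _)
  · refine le_add_of_nonneg_of_le (by positivity) ?_
    rw [schwartz_laplacian_eq_sum]
    have hs : (∑ i, ∂_{unitVec i} (∂_{unitVec i} (schwartzMul (dilatedBump n) φ))) x
        = ∑ i, (∂_{unitVec i} (∂_{unitVec i} (schwartzMul (dilatedBump n) φ))) x := by
      simp
    rw [hs]
    refine (Finset.abs_sum_le_sum_abs _ _).trans (Finset.sum_le_sum fun i _ => ?_)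
    have he : (∂_{unitVec i} (∂_{unitVec i} (schwartzMul (dilatedBump n) φ))) x
        = ∂_{unitVec i} (∂_{unitVec i} (dilatedBump n)) x * φ x
          + 2 * (∂_{unitVec i} (dilatedBump n) x * ∂_{unitVec i} φ x)
          + dilatedBump n x * ∂_{unitVec i} (∂_{unitVec i} φ) x := by
      rw [lineDerivOp_schwartzMul, LineDeriv.lineDerivOp_add, lineDerivOp_schwartzMul,
        lineDerivOp_schwartzMul]
      simp only [add_apply, schwartzMul_apply]
      ring
    rw [he]
    refine (abs_add_le _ _).trans (add_le_add ((abs_add_le _ _).trans (add_le_add ?_ ?_)) ?_)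
    · rw [abs_mul]
      exact mul_le_mul_of_nonneg_right (b2 n i x) (abs_nonneg _)
    · rw [abs_mul, abs_mul, abs_of_pos (two_pos : (0 : ℝ) < 2)]
      exact mul_le_mul_of_nonneg_left
        (mul_le_mul_of_nonneg_right (b1 n i x) (abs_nonneg _)) two_pos.le
    · rw [abs_mul]
      exact mul_le_mul_of_nonneg_right (b0 n x) (abs_nonneg _)

lemma tendsto_integral_dilatedBump_mul (w : L2) (φ : 𝓢(E3, ℝ)) :
    Tendsto (fun n => ∫ x, w x * schwartzMul (dilatedBump n) φ x) atTop
        (𝓝 (∫ x, w x * φ x)) ∧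
      Tendsto (fun n => ∫ x, w x * Laplacian.laplacian (schwartzMul (dilatedBump n) φ : E3 → ℝ) x)
        atTop (𝓝 (∫ x, w x * Laplacian.laplacian (φ : E3 → ℝ) x)) := by
  obtain ⟨K, hK, hbd⟩ := exists_memLp_bound_dilatedBump_mul φ
  have hint : Integrable fun x => |w x| * K x := (Lp.memLp w).abs.integrable_mul hK
  constructor
  · refine tendsto_integral_of_dominated_convergence _ (fun n =>
      (Lp.aestronglyMeasurable w).mul (SchwartzMap.continuous _).aestronglyMeasurable) hint
      (fun n => Eventually.of_forall fun x => ?_) (Eventually.of_forall fun x => ?_)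
    · rw [Real.norm_eq_abs, abs_mul]
      exact mul_le_mul_of_nonneg_left (hbd n x).1 (abs_nonneg _)
    · refine Tendsto.const_mul _ (tendsto_const_nhds.congr' ?_)
      filter_upwards [eventually_dilatedBump_mul_eq φ x] with n hn using hn.eq_of_nhds.symm
  · simp only [← SchwartzMap.laplacian_apply]
    refine tendsto_integral_of_dominated_convergence _ (fun n =>
      (Lp.aestronglyMeasurable w).mul (SchwartzMap.continuous _).aestronglyMeasurable) hint
      (fun n => Eventually.of_forall fun x => ?_) (Eventually.of_forall fun x => ?_)
    · rw [Real.norm_eq_abs, abs_mul]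
      exact mul_le_mul_of_nonneg_left (hbd n x).2 (abs_nonneg _)
    · refine Tendsto.const_mul _ (tendsto_const_nhds.congr' ?_)
      filter_upwards [eventually_dilatedBump_mul_eq φ x] with n hn
      rw [SchwartzMap.laplacian_apply, SchwartzMap.laplacian_apply]
      exact (InnerProductSpace.laplacian_congr_nhds hn).eq_of_nhds.symm

/-- Distributional Laplacians in `L²` may be tested against Schwartz functions. -/
lemma HasWeakLaplacian.integral_mul_schwartz {w f : L2} (h : HasWeakLaplacian w f)
    (φ : 𝓢(E3, ℝ)) :
    inner ℝ w (schwartzL2 (Δ φ)) = inner ℝ f (schwartzL2 φ) := by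
  rw [inner_schwartzL2, inner_schwartzL2]
  simp only [SchwartzMap.laplacian_apply]
  refine tendsto_nhds_unique (tendsto_integral_dilatedBump_mul w φ).2
    ((tendsto_integral_dilatedBump_mul f φ).1.congr fun n => ?_)
  exact (h _ (isTest_dilatedBump_mul n φ)).symm

/-- The Green function represents the resolvent on Schwartz functions. -/
lemma inner_greenL2_schwartz {lam : ℝ} (hlam : 0 < lam) (y : E3) (φ : 𝓢(E3, ℝ)) :
    inner ℝ (greenL2 hlam y) (schwartzL2 (lam • φ - Δ φ)) = φ y := by
  rw [schwartzL2_sub, schwartzL2_smul, inner_sub_right, inner_smul_right, inner_schwartzL2,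
    inner_schwartzL2]
  simp only [SchwartzMap.laplacian_apply]
  have h := tendsto_integral_dilatedBump_mul (greenL2 hlam y) φ
  refine tendsto_nhds_unique ((h.1.const_mul lam).sub h.2) (tendsto_const_nhds.congr' ?_)
  filter_upwards [eventually_dilatedBump_mul_eq φ y] with n hn
  rw [integral_mul_congr_ae (coeFn_greenL2 hlam y), integral_mul_congr_ae (coeFn_greenL2 hlam y),
    integral_greenFun_mul_laplacian hlam.le y (isTest_dilatedBump_mul n φ), hn.eq_of_nhds]
  ring

end Cutoff

/-! ### The resolvent of the Laplacian on square integrable functions -/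

section FreeResolvent

open scoped SchwartzMap LineDeriv Laplacian

lemma exists_seq_tendsto_schwartzL2 (f : L2) :
    ∃ ψ : ℕ → 𝓢(E3, ℝ), Tendsto (fun n => schwartzL2 (ψ n)) atTop (𝓝 f) := by
  have hd : DenseRange (SchwartzMap.toLpCLM ℝ ℝ 2 (volume : Measure E3)) :=
    SchwartzMap.denseRange_toLpCLM (F := ℝ) (by norm_num)
  obtain ⟨x, hx, hlim⟩ := mem_closure_iff_seq_limit.1 (hd f)
  choose ψ hψ using hx
  exact ⟨ψ, (funext hψ : (fun n => schwartzL2 (ψ n)) = x) ▸ hlim⟩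

/-- A linear operation on Schwartz functions that is bounded by the norm of the right-hand side of
the resolvent equation turns convergence of the right-hand sides into convergence of its values. -/
lemma exists_tendsto_of_norm_le {lam C : ℝ} (L : 𝓢(E3, ℝ) →L[ℝ] L2)
    (hL : ∀ φ, ‖L φ‖ ≤ C * ‖schwartzL2 (lam • φ - Δ φ)‖) {φ ψ : ℕ → 𝓢(E3, ℝ)} {f : L2}
    (hφ : ∀ n, lam • φ n - Δ (φ n) = ψ n)
    (hψ : Tendsto (fun n => schwartzL2 (ψ n)) atTop (𝓝 f)) :
    ∃ g, Tendsto (fun n => L (φ n)) atTop (𝓝 g) := by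
  refine cauchySeq_tendsto_of_complete (cauchySeq_iff_tendsto_dist_atTop_0.2 ?_)
  have h := (cauchySeq_iff_tendsto_dist_atTop_0.1 hψ.cauchySeq).const_mul C
  rw [mul_zero] at h
  refine squeeze_zero (fun _ => dist_nonneg) (fun p => ?_) h
  have hsub : lam • (φ p.1 - φ p.2) - Δ (φ p.1 - φ p.2) = ψ p.1 - ψ p.2 := by
    have : Δ (φ p.1 - φ p.2) = Δ (φ p.1) - Δ (φ p.2) :=
      map_sub (LineDeriv.laplacianCLM ℝ E3 𝓢(E3, ℝ)) _ _
    rw [this, smul_sub, ← hφ, ← hφ]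
    abel
  have := hL (φ p.1 - φ p.2)
  rw [hsub, map_sub, schwartzL2_sub] at this
  simpa [dist_eq_norm] using this

/-- A test function as a Schwartz function. -/
noncomputable def IsTest.toSchwartz {χ : E3 → ℝ} (hχ : IsTest χ) : 𝓢(E3, ℝ) :=
  hχ.2.toSchwartzMap hχ.1

lemma inner_schwartz_laplacian_right (φ X : 𝓢(E3, ℝ)) :
    inner ℝ (schwartzL2 φ) (schwartzL2 (Δ X)) = inner ℝ (schwartzL2 (Δ φ)) (schwartzL2 X) := by
  rw [inner_schwartzL2_schwartzL2, inner_schwartzL2_schwartzL2]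
  exact SchwartzMap.integral_mul_laplacian_right_eq_left φ X

lemma hasWeakPartial_of_tendsto {φ : ℕ → 𝓢(E3, ℝ)} {u g : L2} {i : Fin 3}
    (hu : Tendsto (fun n => schwartzL2 (φ n)) atTop (𝓝 u))
    (hg : Tendsto (fun n => schwartzL2 (∂_{unitVec i} (φ n))) atTop (𝓝 g)) :
    HasWeakPartial i u g := fun χ hχ => by
  have h1 := hu.inner (𝕜 := ℝ) (tendsto_const_nhds (x := schwartzL2 (∂_{unitVec i} hχ.toSchwartz)))
  have h2 := (hg.inner (𝕜 := ℝ) (tendsto_const_nhds (x := schwartzL2 hχ.toSchwartz))).neg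
  simp only [inner_lineDerivOp_right] at h1
  have h3 := tendsto_nhds_unique h1 h2
  rwa [inner_schwartzL2, inner_schwartzL2] at h3

lemma hasWeakSecondPartial_of_tendsto {φ : ℕ → 𝓢(E3, ℝ)} {u g : L2} {i j : Fin 3}
    (hu : Tendsto (fun n => schwartzL2 (φ n)) atTop (𝓝 u))
    (hg : Tendsto (fun n => schwartzL2 (∂_{unitVec j} (∂_{unitVec i} (φ n)))) atTop (𝓝 g)) :
    HasWeakSecondPartial i j u g := fun χ hχ => by
  have h1 := hu.inner (𝕜 := ℝ)
    (tendsto_const_nhds (x := schwartzL2 (∂_{unitVec i} (∂_{unitVec j} hχ.toSchwartz))))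
  have h2 := hg.inner (𝕜 := ℝ) (tendsto_const_nhds (x := schwartzL2 hχ.toSchwartz))
  simp only [inner_lineDerivOp_right, neg_neg] at h1
  have h3 := tendsto_nhds_unique h1 h2
  rw [inner_schwartzL2, inner_schwartzL2] at h3
  simp only [iteratedFDeriv_two_eq_fderiv_fderiv hχ.1]
  exact h3

lemma hasWeakLaplacian_of_tendsto {φ : ℕ → 𝓢(E3, ℝ)} {u g : L2}
    (hu : Tendsto (fun n => schwartzL2 (φ n)) atTop (𝓝 u))
    (hg : Tendsto (fun n => schwartzL2 (Δ (φ n))) atTop (𝓝 g)) :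
    HasWeakLaplacian u g := fun χ hχ => by
  have h1 := hu.inner (𝕜 := ℝ) (tendsto_const_nhds (x := schwartzL2 (Δ hχ.toSchwartz)))
  have h2 := hg.inner (𝕜 := ℝ) (tendsto_const_nhds (x := schwartzL2 hχ.toSchwartz))
  simp only [inner_schwartz_laplacian_right] at h1
  have h3 := tendsto_nhds_unique h1 h2
  rw [inner_schwartzL2, inner_schwartzL2] at h3
  simp only [SchwartzMap.laplacian_apply] at h3
  exact h3

lemma norm_greenL2 {lam : ℝ} (hlam : 0 < lam) (y : E3) :
    ‖greenL2 hlam y‖ = ‖greenL2 hlam 0‖ := by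
  simp only [greenL2, Lp.norm_toLp]
  congr 1
  have := eLpNorm_comp_measurePreserving (p := 2)
    (measurable_greenFun lam 0).aestronglyMeasurable
    (measurePreserving_sub_right (volume : Measure E3) y)
  rw [← this]
  congr 1
  ext x
  simp [greenFun]

/-- The resolvent of `-Δ` on `L²(ℝ³)`, with its mapping properties: the solution lies in `H²`, is
bounded and continuous, and its pointwise values are given by the Green function. -/
lemma exists_freeResolvent {lam : ℝ} (hlam : 0 < lam) (f : L2) :
    ∃ u : L2, u ∈ H2 ∧ HasWeakLaplacian u ((lam • u - f : L2) : E3 → ℝ) ∧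
      lam * ‖u‖ ^ 2 ≤ inner ℝ f u ∧
      (u : E3 → ℝ) =ᵐ[volume] (fun y => inner ℝ (greenL2 hlam y) f) ∧
      (fun y => inner ℝ (greenL2 hlam y) f) ∈ Htilde2 := by
  obtain ⟨ψ, hψ⟩ := exists_seq_tendsto_schwartzL2 f
  choose φ hφ using fun n => exists_smul_sub_laplacian_eq hlam (ψ n)
  obtain ⟨u, hu⟩ := exists_tendsto_of_norm_le (SchwartzMap.toLpCLM ℝ ℝ 2 (volume : Measure E3))
    (norm_schwartz_le hlam) hφ hψ
  have hu' : Tendsto (fun n => schwartzL2 (φ n)) atTop (𝓝 u) := hu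
  have hgrad : ∀ i : Fin 3, ∃ g : L2,
      Tendsto (fun n => schwartzL2 (∂_{unitVec i} (φ n))) atTop (𝓝 g) := fun i =>
    exists_tendsto_of_norm_le ((SchwartzMap.toLpCLM ℝ ℝ 2 (volume : Measure E3)).comp
      (LineDeriv.lineDerivOpCLM ℝ 𝓢(E3, ℝ) (unitVec i)))
      (fun φ => norm_schwartz_lineDerivOp_le hlam φ i) hφ hψ
  have hsec : ∀ i j : Fin 3, ∃ g : L2,
      Tendsto (fun n => schwartzL2 (∂_{unitVec j} (∂_{unitVec i} (φ n)))) atTop (𝓝 g) :=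
    fun i j => exists_tendsto_of_norm_le ((SchwartzMap.toLpCLM ℝ ℝ 2 (volume : Measure E3)).comp
      ((LineDeriv.lineDerivOpCLM ℝ 𝓢(E3, ℝ) (unitVec j)).comp
        (LineDeriv.lineDerivOpCLM ℝ 𝓢(E3, ℝ) (unitVec i))))
      (fun φ => (norm_schwartz_second_le φ j i).trans (norm_schwartz_laplacian_le hlam φ)) hφ hψ
  have hlap : Tendsto (fun n => schwartzL2 (Δ (φ n))) atTop (𝓝 (lam • u - f)) := by
    refine ((hu'.const_smul lam).sub hψ).congr fun n => ?_
    rw [← hφ n, schwartzL2_sub, schwartzL2_smul, sub_sub_cancel]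
  have hweak := hasWeakLaplacian_of_tendsto hu' hlap
  -- the Green function bounds the uniform norm by the `L²` norm of the data
  have hunif : TendstoUniformly (fun n y => φ n y) (fun y => inner ℝ (greenL2 hlam y) f) atTop := by
    have h0 := (tendsto_iff_norm_sub_tendsto_zero.1 hψ).const_mul ‖greenL2 hlam 0‖
    rw [mul_zero] at h0
    rw [Metric.tendstoUniformly_iff]
    intro ε hε
    filter_upwards [h0.eventually_lt_const hε] with n hn y
    refine lt_of_le_of_lt ?_ hn
    rw [← inner_greenL2_schwartz hlam y (φ n), hφ, dist_comm, dist_eq_norm, ← inner_sub_right,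
      ← norm_greenL2 hlam y]
    exact norm_inner_le_norm _ _
  have hae : (u : E3 → ℝ) =ᵐ[volume] (fun y => inner ℝ (greenL2 hlam y) f) := by
    obtain ⟨ns, hns, hlim⟩ := (tendstoInMeasure_of_tendsto_Lp hu').exists_seq_tendsto_ae
    filter_upwards [hlim, ae_all_iff.2 fun n => coeFn_schwartzL2 (φ n)] with x hx hx'
    simp only [hx'] at hx
    exact tendsto_nhds_unique hx ((hunif.tendsto_at x).comp hns.tendsto_atTop)
  have hcont : Continuous fun y => inner ℝ (greenL2 hlam y) f :=
    hunif.continuous (Frequently.of_forall fun n => (φ n).continuous)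
  refine ⟨u, fun i j => ?_, hweak, ?_, hae, hcont, ⟨‖greenL2 hlam 0‖ * ‖f‖, fun y => ?_⟩,
    fun i => ?_, lam • u - f, hweak.congr_ae hae (ae_eq_refl _)⟩
  · obtain ⟨g, hg⟩ := hsec i j
    exact ⟨g, hasWeakSecondPartial_of_tendsto hu' hg⟩
  · refine le_of_tendsto_of_tendsto' ((hu'.norm.pow 2).const_mul lam) (hψ.inner (𝕜 := ℝ) hu') fun n => ?_
    rw [← hφ n, inner_resolvent_schwartz]
    exact le_add_of_nonneg_right (Finset.sum_nonneg fun i _ => sq_nonneg _)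
  · rw [← norm_greenL2 hlam y]
    exact abs_real_inner_le_norm _ _
  · obtain ⟨g, hg⟩ := hgrad i
    exact ⟨g, (hasWeakPartial_of_tendsto hu' hg).congr_ae hae (ae_eq_refl _)⟩

/-- `-Δ + lam` is injective on the square integrable functions, in the sense of distributions. -/
lemma eq_zero_of_hasWeakLaplacian {lam : ℝ} (hlam : 0 < lam) {w : L2}
    (hw : HasWeakLaplacian w ((lam • w : L2) : E3 → ℝ)) : w = 0 := by
  have h0 : ∀ ψ : 𝓢(E3, ℝ), inner ℝ w (schwartzL2 ψ) = 0 := fun ψ => by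
    obtain ⟨φ, hφ⟩ := exists_smul_sub_laplacian_eq hlam ψ
    rw [← hφ, schwartzL2_sub, schwartzL2_smul, inner_sub_right, inner_smul_right,
      hw.integral_mul_schwartz φ, inner_smul_left]
    simp
  obtain ⟨ψ, hψ⟩ := exists_seq_tendsto_schwartzL2 w
  have := tendsto_nhds_unique ((tendsto_const_nhds (x := w)).inner (𝕜 := ℝ) hψ)
    (tendsto_const_nhds.congr fun n => (h0 (ψ n)).symm)
  exact inner_self_eq_zero.1 this

/-- The resolvent `(-Δ + lam)⁻¹` on `L²(ℝ³)`. -/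
noncomputable def freeResolvent {lam : ℝ} (hlam : 0 < lam) (f : L2) : L2 :=
  Classical.choose (exists_freeResolvent hlam f)

variable {lam : ℝ} (hlam : 0 < lam)

lemma freeResolvent_mem_H2 (f : L2) : freeResolvent hlam f ∈ H2 :=
  (Classical.choose_spec (exists_freeResolvent hlam f)).1

lemma hasWeakLaplacian_freeResolvent (f : L2) :
    HasWeakLaplacian (freeResolvent hlam f)
      ((lam • freeResolvent hlam f - f : L2) : E3 → ℝ) :=
  (Classical.choose_spec (exists_freeResolvent hlam f)).2.1

lemma mul_norm_sq_freeResolvent_le (f : L2) :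
    lam * ‖freeResolvent hlam f‖ ^ 2 ≤ inner ℝ f (freeResolvent hlam f) :=
  (Classical.choose_spec (exists_freeResolvent hlam f)).2.2.1

lemma freeResolvent_ae_eq (f : L2) :
    (freeResolvent hlam f : E3 → ℝ) =ᵐ[volume] fun y => inner ℝ (greenL2 hlam y) f :=
  (Classical.choose_spec (exists_freeResolvent hlam f)).2.2.2.1

lemma inner_greenL2_mem_Htilde2 (f : L2) : (fun y => inner ℝ (greenL2 hlam y) f) ∈ Htilde2 :=
  (Classical.choose_spec (exists_freeResolvent hlam f)).2.2.2.2

lemma eq_freeResolvent {w f : L2} (hw : HasWeakLaplacian w ((lam • w - f : L2) : E3 → ℝ)) :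
    w = freeResolvent hlam f := by
  have h := hw.coe_add_smul (hasWeakLaplacian_freeResolvent hlam f) (locallyIntegrable_coe _)
    (locallyIntegrable_coe _) (-1)
  refine sub_eq_zero.1 (eq_zero_of_hasWeakLaplacian hlam ?_)
  have e1 : lam • w - f + (-1 : ℝ) • (lam • freeResolvent hlam f - f)
      = lam • (w - freeResolvent hlam f) := by
    rw [neg_one_smul, smul_sub]; abel
  have e2 : w - freeResolvent hlam f = w + (-1 : ℝ) • freeResolvent hlam f := by
    rw [neg_one_smul, sub_eq_add_neg]
  rw [e1] at h
  rw [e2] at h ⊢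
  exact h.congr_ae (coeFn_add_smul _ _ _) (ae_eq_refl _)

lemma freeResolvent_sub (f g : L2) :
    freeResolvent hlam (f - g) = freeResolvent hlam f - freeResolvent hlam g := by
  refine (eq_freeResolvent hlam ?_).symm
  have h := (hasWeakLaplacian_freeResolvent hlam f).coe_add_smul
    (hasWeakLaplacian_freeResolvent hlam g) (locallyIntegrable_coe _)
    (locallyIntegrable_coe _) (-1)
  have e1 : lam • freeResolvent hlam f - f + (-1 : ℝ) • (lam • freeResolvent hlam g - g)
      = lam • (freeResolvent hlam f - freeResolvent hlam g) - (f - g) := by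
    rw [neg_one_smul, smul_sub]; abel
  have e2 : freeResolvent hlam f - freeResolvent hlam g
      = freeResolvent hlam f + (-1 : ℝ) • freeResolvent hlam g := by
    rw [neg_one_smul, sub_eq_add_neg]
  rw [e1] at h
  rw [e2] at h ⊢
  exact h.congr_ae (coeFn_add_smul _ _ _) (ae_eq_refl _)

/-- `freeLaplacian` is the negative distributional Laplacian. -/
lemma hasWeakLaplacian_neg_freeLaplacian (u : H2) :
    HasWeakLaplacian (u : L2) ((-freeLaplacian u : L2) : E3 → ℝ) := fun χ hχ => by
  have hs := fun i => Classical.choose_spec (u.2 i i) χ hχ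
  have hi : ∀ i : Fin 3, Integrable fun x =>
      (u : L2) x * iteratedFDeriv ℝ 2 χ x ![unitVec i, unitVec i] := fun i => by
    simp only [iteratedFDeriv_two_eq_fderiv_fderiv hχ.1]
    exact integrable_mul_of_isTest (locallyIntegrable_coe _)
      ((hχ.fderiv_apply (unitVec i)).fderiv_apply (unitVec i))
  simp only [laplacian_eq_sum_iteratedFDeriv, Finset.mul_sum]
  rw [integral_finsetSum _ fun i _ => hi i, Finset.sum_congr rfl fun i _ => hs i,
    freeLaplacian, neg_neg]
  have h : ∀ g : L2, ∫ x, g x * χ x = inner ℝ g (schwartzL2 hχ.toSchwartz) := fun g =>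
    (inner_schwartzL2 g hχ.toSchwartz).symm
  simp only [h, sum_inner]

lemma isResolvent_freeResolvent : IsResolvent freeLaplacian lam (freeResolvent hlam) := by
  refine ⟨fun u => ?_, fun f => ⟨⟨_, freeResolvent_mem_H2 hlam f⟩, rfl, ?_⟩⟩
  · refine (eq_freeResolvent hlam ?_).symm
    have := hasWeakLaplacian_neg_freeLaplacian u
    rwa [show lam • (u : L2) - (freeLaplacian u + lam • (u : L2)) = -freeLaplacian u by abel]
  · have h := (hasWeakLaplacian_neg_freeLaplacian ⟨_, freeResolvent_mem_H2 hlam f⟩).unique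
      (hasWeakLaplacian_freeResolvent hlam f)
    rw [← neg_neg (freeLaplacian _), h]
    simp

end FreeResolvent

/-! ### Decompositions, traces and the resolvent formula -/

section PointInteractions

variable {Y : Finset E3}

lemma G_apply {lam : ℝ} (hlam : 0 < lam) (ξ : Coord Y) :
    G Y hlam ξ = ∑ y : Y, ξ y • greenL2 hlam y := by
  simp [G, greenL2]

lemma adjoint_G_apply {lam : ℝ} (hlam : 0 < lam) (f : L2) (y : Y) :
    ContinuousLinearMap.adjoint (G Y hlam) f y = inner ℝ (greenL2 hlam (y : E3)) f := by
  classical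
  have h1 := ContinuousLinearMap.adjoint_inner_right (G Y hlam) (EuclideanSpace.single y 1) f
  rw [EuclideanSpace.inner_single_left, G_apply, Finset.sum_eq_single y] at h1
  · simpa using h1
  · intro z _ hz
    simp [hz]
  · simp

lemma G0_eq_sum (ξ : Coord Y) (x : E3) : G0 Y ξ x = ∑ y : Y, ξ y * greenFun 0 y x := by
  rw [G0, Finset.mul_sum]
  refine Finset.sum_congr rfl fun y _ => ?_
  simp only [greenFun, Real.sqrt_zero, neg_zero, zero_mul, Real.exp_zero]
  rw [div_mul_div_comm, one_mul, mul_one_div]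

lemma G0_eq_add_sum_erase [DecidableEq Y] (ξ : Coord Y) (y : Y) (x : E3) :
    G0 Y ξ x = 1 / (4 * Real.pi) * (ξ y / ‖x - (y : E3)‖)
      + ∑ z ∈ Finset.univ.erase y, ξ z * greenFun 0 z x := by
  rw [G0_eq_sum, ← Finset.add_sum_erase _ _ (Finset.mem_univ y)]
  congr 1
  simp only [greenFun, Real.sqrt_zero, neg_zero, zero_mul, Real.exp_zero]
  rw [div_mul_div_comm, one_mul, mul_one_div]

lemma continuousAt_greenFun (lam : ℝ) {y x : E3} (h : x ≠ y) : ContinuousAt (greenFun lam y) x := by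
  have : ‖x - y‖ ≠ 0 := norm_ne_zero_iff.2 (sub_ne_zero.2 h)
  unfold greenFun
  exact ContinuousAt.div (by fun_prop) (by fun_prop) (by positivity)

lemma continuousAt_sum_erase_greenFun [DecidableEq Y] (ξ : Coord Y) (y : Y) :
    ContinuousAt (fun x : E3 => ∑ z ∈ Finset.univ.erase y, ξ z * greenFun 0 z x) (y : E3) := by
  refine tendsto_finsetSum _ fun z hz => ?_
  have hne : (y : E3) ≠ z := fun h => (Finset.mem_erase.1 hz).1 (Subtype.ext h.symm)
  exact (continuousAt_greenFun 0 hne).tendsto.const_mul _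

/-- The trace exists for every continuous `u₀` and is given by evaluating the part of `u₀ + G₀ ξ` that
is regular at the point. -/
lemma hasTrace_iff [DecidableEq Y] {u₀ : E3 → ℝ} (hu₀ : Continuous u₀) {ξ η : Coord Y} :
    HasTrace Y u₀ ξ η ↔
      ∀ y : Y, η y = u₀ y + ∑ z ∈ Finset.univ.erase y, ξ z * greenFun 0 z (y : E3) := by
  refine forall_congr' fun y => ?_
  have hc : Tendsto (fun x : E3 => u₀ x + G0 Y ξ x - 1 / (4 * Real.pi) * (ξ y / ‖x - (y : E3)‖))
      (𝓝[≠] (y : E3))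
      (𝓝 (u₀ y + ∑ z ∈ Finset.univ.erase y, ξ z * greenFun 0 z (y : E3))) := by
    have h := (hu₀.continuousAt (x := (y : E3))).add (continuousAt_sum_erase_greenFun ξ y)
    refine (h.tendsto.mono_left nhdsWithin_le_nhds).congr fun x => ?_
    rw [G0_eq_add_sum_erase ξ y x, Pi.add_apply]
    ring
  exact ⟨fun h => tendsto_nhds_unique h hc, fun h => h ▸ hc⟩

lemma frequently_nhdsNE_of_ae {p : E3 → Prop} (h : ∀ᵐ x, p x) (y : E3) :
    ∃ᶠ x in 𝓝[≠] y, p x := by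
  have hne : ∀ᵐ x : E3, x ≠ y := by simp [ae_iff]
  have hd := Measure.dense_of_ae (h.and hne)
  exact frequently_nhdsWithin_iff.2 (mem_closure_iff_frequently.1 (hd y))

/-- The decomposition `u = u₀ + G₀ ξ` with `u₀` continuous is unique: the coefficients `ξ` are read
off from the singularities at the points of `Y`. -/
lemma decomp_unique {u₀ v₀ : E3 → ℝ} (hu : Continuous u₀) (hv : Continuous v₀) {ξ ζ : Coord Y}
    (h : (fun x => u₀ x + G0 Y ξ x) =ᵐ[volume] fun x => v₀ x + G0 Y ζ x) :
    ξ = ζ ∧ u₀ = v₀ := by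
  classical
  have hξ : ξ = ζ := by
    ext y
    set s : E3 → ℝ := fun x => u₀ x - v₀ x
      + ((∑ z ∈ Finset.univ.erase y, ξ z * greenFun 0 z x)
        - ∑ z ∈ Finset.univ.erase y, ζ z * greenFun 0 z x) with hs
    have hsc : ContinuousAt s (y : E3) := (hu.sub hv).continuousAt.add
      ((continuousAt_sum_erase_greenFun ξ y).sub (continuousAt_sum_erase_greenFun ζ y))
    -- `‖x - y‖` times the difference of the two sides vanishes on a set accumulating at `y`, and tends
    -- to the difference of the coefficients
    have hlim : Tendsto (fun x : E3 => ‖x - (y : E3)‖ * s x + 1 / (4 * Real.pi) * (ξ y - ζ y))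
        (𝓝[≠] (y : E3)) (𝓝 (1 / (4 * Real.pi) * (ξ y - ζ y))) := by
      have h1 : ContinuousAt (fun x : E3 => ‖x - (y : E3)‖ * s x
          + 1 / (4 * Real.pi) * (ξ y - ζ y)) (y : E3) :=
        (ContinuousAt.mul (by fun_prop) hsc).add continuousAt_const
      have h2 := h1.tendsto
      rw [sub_self, norm_zero, zero_mul, zero_add] at h2
      exact h2.mono_left nhdsWithin_le_nhds
    have hfreq : ∃ᶠ x in 𝓝[≠] (y : E3),
        ‖x - (y : E3)‖ * s x + 1 / (4 * Real.pi) * (ξ y - ζ y) ∈ ({0} : Set ℝ) := by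
      have hf := (frequently_nhdsNE_of_ae h (y : E3)).and_eventually
        (self_mem_nhdsWithin : ({(y : E3)}ᶜ : Set E3) ∈ 𝓝[≠] (y : E3))
      refine hf.mono fun x hx => ?_
      obtain ⟨hx1, hx2⟩ := hx
      simp only at hx1
      have hr : ‖x - (y : E3)‖ ≠ 0 := norm_ne_zero_iff.2 (sub_ne_zero.2 hx2)
      rw [G0_eq_add_sum_erase ξ y, G0_eq_add_sum_erase ζ y] at hx1
      have hs' : s x = 1 / (4 * Real.pi) * (ζ y / ‖x - (y : E3)‖)
          - 1 / (4 * Real.pi) * (ξ y / ‖x - (y : E3)‖) := by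
        simp only [hs]; linarith
      rw [Set.mem_singleton_iff, hs']
      field_simp
      ring
    have h0 : 1 / (4 * Real.pi) * (ξ y - ζ y) = 0 :=
      isClosed_singleton.mem_of_frequently_of_tendsto hfreq hlim
    have hpi : 1 / (4 * Real.pi) ≠ 0 := by positivity
    exact sub_eq_zero.1 ((mul_eq_zero.1 h0).resolve_left hpi)
  refine ⟨hξ, (Continuous.ae_eq_iff_eq volume hu hv).1 ?_⟩
  subst hξ
  filter_upwards [h] with x hx using add_right_cancel hx

lemma IsDecomp.unique {u : L2} {u₀ v₀ : E3 → ℝ} {ξ ζ : Coord Y} (hu : IsDecomp Y u u₀ ξ)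
    (hv : IsDecomp Y u v₀ ζ) : ξ = ζ ∧ u₀ = v₀ :=
  decomp_unique hu.1.1 hv.1.1 (hu.2.symm.trans hv.2)

lemma hasWeakLaplacian_zero : HasWeakLaplacian (fun _ => 0) ((0 : L2) : E3 → ℝ) := fun φ _ => by
  rw [integral_mul_congr_ae (Lp.coeFn_zero ℝ 2 (volume : Measure E3))]
  simp

/-- The regular part `G_lam ξ - G₀ ξ` lies in `H̃²`, and its Laplacian is `lam G_lam ξ`; stated for
sums over a subset of `Y`. -/
lemma regularPart {lam : ℝ} (hlam : 0 < lam) (ξ : Coord Y) (s : Finset Y) :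
    (fun x => ∑ y ∈ s, ξ y * regKernel lam y x) ∈ Htilde2 ∧
      HasWeakLaplacian (fun x => ∑ y ∈ s, ξ y * regKernel lam y x)
        ((lam • ∑ y ∈ s, ξ y • greenL2 hlam y : L2) : E3 → ℝ) ∧
      ((∑ y ∈ s, ξ y • greenL2 hlam y : L2) : E3 → ℝ) =ᵐ[volume]
        fun x => ∑ y ∈ s, (ξ y * regKernel lam y x + ξ y * greenFun 0 y x) := by
  classical
  induction s using Finset.induction_on with
  | empty =>
    simp only [Finset.sum_empty, smul_zero]
    exact ⟨⟨continuous_const, ⟨0, by simp⟩, fun i => ⟨0, fun φ _ => by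
      rw [integral_mul_congr_ae (Lp.coeFn_zero ℝ 2 (volume : Measure E3))]; simp⟩,
      0, hasWeakLaplacian_zero⟩, hasWeakLaplacian_zero, Lp.coeFn_zero ℝ 2 _⟩
  | insert y s hy ih =>
    obtain ⟨h1, h2, h3⟩ := ih
    simp only [Finset.sum_insert hy]
    rw [add_comm (ξ y • _) (∑ z ∈ s, ξ z • greenL2 hlam (z : E3)),
      show (fun x => ξ y * regKernel lam y x + ∑ z ∈ s, ξ z * regKernel lam z x)
        = fun x => ∑ z ∈ s, ξ z * regKernel lam z x + ξ y * regKernel lam y x from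
        funext fun x => add_comm _ _]
    refine ⟨Htilde2.add_const_mul h1 (regKernel_mem_Htilde2 hlam y) (ξ y), ?_, ?_⟩
    · rw [smul_add, smul_comm lam (ξ y)]
      exact h2.coe_add_smul (hasWeakLaplacian_regKernel_coe hlam y)
        (Htilde2.locallyIntegrable h1) (locallyIntegrable_regKernel lam y) (ξ y)
    · filter_upwards [(coeFn_add_smul (∑ z ∈ s, ξ z • greenL2 hlam z) (greenL2 hlam y) (ξ y)).symm,
        h3, coeFn_greenL2 hlam (y : E3), regKernel_ae_eq lam (y : E3)] with x e1 e2 e3 e4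
      rw [e1, e2, e3, ← e4, add_comm]
      congr 1
      ring

lemma M_apply_self (lam : ℝ) (y : Y) : M Y lam y y = √lam / (4 * Real.pi) := by
  simp [M]
  ring

lemma M_apply_of_ne (lam : ℝ) {y z : Y} (h : y ≠ z) : M Y lam y z = -greenFun lam z (y : E3) := by
  simp only [M, greenFun, if_neg h]
  rw [mul_neg, div_mul_div_comm, one_mul]

lemma MOp_apply (lam : ℝ) (ξ : Coord Y) (y : Y) : MOp Y lam ξ y = ∑ z, M Y lam y z * ξ z := by
  simp [MOp, Matrix.toLpLin_apply, Matrix.mulVec, dotProduct]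

/-- The function `(-Δ + lam)⁻¹ f + G_lam ξ` is decomposed as `u₀ + G₀ ξ`, with explicit trace and
Laplacian. -/
lemma exists_decomp {lam : ℝ} (hlam : 0 < lam) (f : L2) (ξ : Coord Y) :
    ∃ u₀ : E3 → ℝ, IsDecomp Y (freeResolvent hlam f + G Y hlam ξ) u₀ ξ ∧
      HasTrace Y u₀ ξ (ContinuousLinearMap.adjoint (G Y hlam) f - MOp Y lam ξ) ∧
      HasWeakLaplacian u₀ ((lam • (freeResolvent hlam f + G Y hlam ξ) - f : L2) : E3 → ℝ) := by
  classical
  obtain ⟨h1, h2, h3⟩ := regularPart hlam ξ Finset.univ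
  rw [← G_apply hlam ξ] at h2 h3
  have hv := inner_greenL2_mem_Htilde2 hlam f
  set v : E3 → ℝ := fun y => inner ℝ (greenL2 hlam y) f with hv_def
  set k : E3 → ℝ := fun x => ∑ y : Y, ξ y * regKernel lam y x with hk_def
  have hmem := Htilde2.add_const_mul hv h1 1
  simp only [one_mul] at hmem
  refine ⟨fun x => v x + k x, ⟨hmem, ?_⟩, (hasTrace_iff hmem.1).2 fun y => ?_, ?_⟩
  · filter_upwards [Lp.coeFn_add (freeResolvent hlam f) (G Y hlam ξ), freeResolvent_ae_eq hlam f,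
      h3] with x e1 e2 e3
    rw [e1, Pi.add_apply, e2, e3, Finset.sum_add_distrib, G0_eq_sum, add_assoc]
  · have hsplit : k (y : E3) = ξ y * regKernel lam y (y : E3)
        + ∑ z ∈ Finset.univ.erase y, ξ z * regKernel lam z (y : E3) :=
      (Finset.add_sum_erase _ _ (Finset.mem_univ y)).symm
    have hM : MOp Y lam ξ y = M Y lam y y * ξ y
        + ∑ z ∈ Finset.univ.erase y, M Y lam y z * ξ z := by
      rw [MOp_apply]
      exact (Finset.add_sum_erase _ (fun z : Y => M Y lam y z * ξ z) (Finset.mem_univ y)).symm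
    have hsum : ∑ z ∈ Finset.univ.erase y, M Y lam y z * ξ z
        = -(∑ z ∈ Finset.univ.erase y, ξ z * regKernel lam z (y : E3)
          + ∑ z ∈ Finset.univ.erase y, ξ z * greenFun 0 z (y : E3)) := by
      rw [← Finset.sum_add_distrib, ← Finset.sum_neg_distrib]
      refine Finset.sum_congr rfl fun z hz => ?_
      have hyz : y ≠ z := (Finset.mem_erase.1 hz).1.symm
      rw [M_apply_of_ne lam hyz, regKernel_of_ne lam fun h => hyz (Subtype.ext h)]
      ring
    rw [PiLp.sub_apply, adjoint_G_apply, hM, hsum, M_apply_self, hsplit, regKernel_self]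
    simp only [hv_def]
    ring
  · have hv2 := (hasWeakLaplacian_freeResolvent hlam f).congr_ae (freeResolvent_ae_eq hlam f)
      (ae_eq_refl _)
    have h := hv2.coe_add_smul h2 (Htilde2.locallyIntegrable hv) (Htilde2.locallyIntegrable h1) 1
    simp only [one_mul, one_smul] at h
    rwa [show lam • (freeResolvent hlam f + G Y hlam ξ) - f
      = lam • freeResolvent hlam f - f + lam • G Y hlam ξ by rw [smul_add]; abel]

/-- Every decomposed function with `-Δ u₀ + lam u = f` is of the form described by
`exists_decomp`. -/
lemma IsDecomp.eq_freeResolvent_add {lam : ℝ} (hlam : 0 < lam) {u f : L2} {u₀ : E3 → ℝ}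
    {ξ η : Coord Y} (hu : IsDecomp Y u u₀ ξ) (ht : HasTrace Y u₀ ξ η)
    (hw : HasWeakLaplacian u₀ ((lam • u - f : L2) : E3 → ℝ)) :
    u = freeResolvent hlam f + G Y hlam ξ ∧
      η = ContinuousLinearMap.adjoint (G Y hlam) f - MOp Y lam ξ := by
  classical
  obtain ⟨h1, h2, h3⟩ := regularPart hlam ξ Finset.univ
  rw [← G_apply hlam ξ] at h2 h3
  have h := hw.coe_add_smul h2 (Htilde2.locallyIntegrable hu.1) (Htilde2.locallyIntegrable h1) (-1)
  have hu' : u = freeResolvent hlam f + G Y hlam ξ := by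
    rw [← sub_eq_iff_eq_add]
    refine eq_freeResolvent hlam ?_
    rw [show lam • u - f + (-1 : ℝ) • lam • G Y hlam ξ = lam • (u - G Y hlam ξ) - f by
      rw [neg_one_smul, smul_sub]; abel] at h
    refine h.congr_ae ?_ (ae_eq_refl _)
    filter_upwards [hu.2, h3, Lp.coeFn_sub u (G Y hlam ξ)] with x e1 e2 e3
    rw [e3, Pi.sub_apply, e1, e2, Finset.sum_add_distrib, G0_eq_sum]
    ring
  refine ⟨hu', ?_⟩
  obtain ⟨v₀, hv, htv, -⟩ := exists_decomp hlam f ξ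
  rw [← hu'] at hv
  obtain ⟨-, rfl⟩ := hu.unique hv
  rw [hasTrace_iff hu.1.1] at ht htv
  ext y
  rw [ht, htv]

lemma G_injective {lam : ℝ} (hlam : 0 < lam) {ξ : Coord Y} (h : G Y hlam ξ = 0) : ξ = 0 := by
  obtain ⟨u₀, hu, -, -⟩ := exists_decomp hlam 0 ξ
  obtain ⟨v₀, hv, -, -⟩ := exists_decomp (Y := Y) hlam 0 0
  rw [h] at hu
  rw [map_zero] at hv
  exact (hu.unique hv).1

/-- The first resolvent identity for the Green functions, and its trace at the points of `Y`. -/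
lemma G_eq_and_MOp_sub {lam mu : ℝ} (hlam : 0 < lam) (hmu : 0 < mu) (ξ : Coord Y) :
    G Y hmu ξ = freeResolvent hlam ((lam - mu) • G Y hmu ξ) + G Y hlam ξ ∧
      MOp Y lam ξ - MOp Y mu ξ
        = ContinuousLinearMap.adjoint (G Y hlam) ((lam - mu) • G Y hmu ξ) := by
  have h0 : freeResolvent hmu 0 = 0 := by
    have := freeResolvent_sub hmu 0 0
    simpa using this
  -- `G_mu ξ` solves the equation at `mu` with datum `0`, and at `lam` with datum `(lam - mu) G_mu ξ`
  obtain ⟨u₀, hu, ht, hw⟩ := exists_decomp hmu 0 ξ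
  rw [h0, zero_add] at hu hw
  have e : mu • G Y hmu ξ - 0 = lam • G Y hmu ξ - (lam - mu) • G Y hmu ξ := by
    rw [sub_smul]; abel
  rw [e] at hw
  obtain ⟨h1, h2⟩ := hu.eq_freeResolvent_add hlam ht hw
  refine ⟨h1, ?_⟩
  rw [map_zero, zero_sub] at h2
  rw [sub_eq_add_neg, h2]
  abel

lemma mul_norm_freeResolvent_le {lam : ℝ} (hlam : 0 < lam) (f : L2) :
    lam * ‖freeResolvent hlam f‖ ≤ ‖f‖ := by
  have h1 := mul_norm_sq_freeResolvent_le hlam f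
  have h2 := real_inner_le_norm f (freeResolvent hlam f)
  rcases (norm_nonneg (freeResolvent hlam f)).eq_or_lt with h0 | h0
  · rw [← h0, mul_zero]; exact norm_nonneg _
  · refine le_of_mul_le_mul_right ?_ h0
    nlinarith

/-- Strict monotonicity of `lam ↦ M_lam`: the difference `M_lam - M_mu = (lam - mu) G_lam^* G_mu` is
positive definite, because `G_lam ξ = ψ - (lam - mu) (-Δ + lam)⁻¹ ψ` for `ψ = G_mu ξ`, and the
subtracted term has norm less than `‖ψ‖`. -/
lemma inner_MOp_lt {lam mu : ℝ} (hmu : 0 < mu) (hml : mu < lam) {ξ : Coord Y} (hξ : ξ ≠ 0) :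
    inner ℝ (MOp Y mu ξ) ξ < inner ℝ (MOp Y lam ξ) ξ := by
  have hlam : 0 < lam := hmu.trans hml
  obtain ⟨h1, h2⟩ := G_eq_and_MOp_sub hlam hmu ξ
  set ψ := G Y hmu ξ with hψ
  have hψ0 : 0 < ‖ψ‖ := norm_pos_iff.2 fun h => hξ (G_injective hmu h)
  set R := freeResolvent hlam ((lam - mu) • ψ) with hR
  have hG : G Y hlam ξ = ψ - R := by rw [h1]; abel
  rw [← sub_pos, ← inner_sub_left, h2, ContinuousLinearMap.adjoint_inner_left, hG,
    inner_smul_left, inner_sub_right, real_inner_self_eq_norm_sq, RCLike.conj_to_real]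
  refine mul_pos (sub_pos.2 hml) ?_
  have h3 := mul_norm_freeResolvent_le hlam ((lam - mu) • ψ)
  rw [← hR, norm_smul, Real.norm_of_nonneg (sub_nonneg.2 hml.le)] at h3
  have h4 := real_inner_le_norm ψ R
  have h5 : ‖R‖ < ‖ψ‖ := by
    by_contra! hle
    nlinarith [mul_pos hmu hψ0, mul_le_mul_of_nonneg_left hle hlam.le]
  nlinarith [mul_lt_mul_of_pos_left h5 hψ0]

lemma continuous_M (y z : Y) : Continuous fun lam => M Y lam y z := by
  unfold M
  split_ifs <;> fun_prop

lemma inner_MOp_zero_lt {lam : ℝ} (hlam : 0 < lam) {ξ : Coord Y} (hξ : ξ ≠ 0) :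
    inner ℝ (MOp Y 0 ξ) ξ < inner ℝ (MOp Y lam ξ) ξ := by
  refine lt_of_le_of_lt ?_ (inner_MOp_lt (half_pos hlam) (half_lt_self hlam) hξ)
  have hc : Continuous fun mu => inner ℝ (MOp Y mu ξ) ξ := by
    simp only [PiLp.inner_apply, MOp_apply]
    have := continuous_M (Y := Y)
    fun_prop
  refine le_of_tendsto ((hc.tendsto 0).mono_left (nhdsWithin_le_nhds (s := Set.Ioi 0))) ?_
  filter_upwards [Ioo_mem_nhdsGT (half_pos hlam)] with mu hmu
  exact (inner_MOp_lt hmu.1 hmu.2 hξ).le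

lemma isSymmetric_MOp (lam : ℝ) : (MOp Y lam).IsSymmetric := by
  classical
  have hM : ∀ y z, M Y lam y z = M Y lam z y := fun y z => by
    unfold M
    rw [norm_sub_rev]
    simp only [eq_comm]
  intro ξ ζ
  simp only [PiLp.inner_apply, MOp_apply, RCLike.inner_apply, RCLike.conj_to_real,
    Finset.sum_mul, Finset.mul_sum]
  rw [Finset.sum_comm]
  refine Finset.sum_congr rfl fun y _ => Finset.sum_congr rfl fun z _ => ?_
  rw [hM]
  ring

end PointInteractions

/-! ### Lower bounds for symmetric operators in finite dimension -/

section Spectral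

variable {F : Type*} [NormedAddCommGroup F] [InnerProductSpace ℝ F] [FiniteDimensional ℝ F]

lemma mul_norm_sq_le_inner_of_isSymmetric {T : F →ₗ[ℝ] F} (hT : T.IsSymmetric) {γ : ℝ}
    (hγ : ∀ μ, Module.End.HasEigenvalue T μ → γ ≤ μ) (x : F) :
    γ * ‖x‖ ^ 2 ≤ inner ℝ (T x) x := by
  set b := hT.eigenvectorBasis rfl
  rw [← b.repr.inner_map_map, ← b.repr.norm_map, EuclideanSpace.real_norm_sq_eq, PiLp.inner_apply,
    Finset.mul_sum]
  refine Finset.sum_le_sum fun i _ => ?_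
  rw [hT.eigenvectorBasis_apply_self_apply]
  have := hγ _ (hT.hasEigenvalue_eigenvalues rfl i)
  simp only [RCLike.inner_apply, RCLike.conj_to_real]
  nlinarith [sq_nonneg (b.repr x i), mul_le_mul_of_nonneg_right this (sq_nonneg (b.repr x i))]

/-- By compactness of the unit sphere, a strict lower bound holds with a uniform gap. -/
lemma exists_pos_mul_norm_sq_le_inner {T : F →ₗ[ℝ] F} {γ : ℝ}
    (hT : ∀ x, x ≠ 0 → γ * ‖x‖ ^ 2 < inner ℝ (T x) x) :
    ∃ ε > 0, ∀ x, (γ + ε) * ‖x‖ ^ 2 ≤ inner ℝ (T x) x := by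
  rcases subsingleton_or_nontrivial F with hF | hF
  · exact ⟨1, one_pos, fun x => by simp [Subsingleton.elim x 0]⟩
  have hTc : Continuous T := T.continuous_of_finiteDimensional
  have hne : (Metric.sphere (0 : F) 1).Nonempty := NormedSpace.sphere_nonempty.2 zero_le_one
  obtain ⟨x₀, hx₀, hmin⟩ := (isCompact_sphere (0 : F) 1).exists_isMinOn hne
    (f := fun x => inner ℝ (T x) x) (by fun_prop)
  have hx₀1 : ‖x₀‖ = 1 := by simpa using hx₀
  have h0 := hT x₀ (norm_pos_iff.1 (by rw [hx₀1]; exact one_pos))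
  rw [hx₀1, one_pow, mul_one] at h0
  refine ⟨_, sub_pos.2 h0, fun x => ?_⟩
  rw [add_sub_cancel]
  rcases eq_or_ne x 0 with rfl | hx
  · simp
  have hx' : ‖x‖ ≠ 0 := norm_ne_zero_iff.2 hx
  have h1 : inner ℝ (T x₀) x₀ ≤ inner ℝ (T (‖x‖⁻¹ • x)) (‖x‖⁻¹ • x) :=
    hmin (by simp [norm_smul, hx'])
  rw [map_smul, inner_smul_left, inner_smul_right, RCLike.conj_to_real] at h1
  calc inner ℝ (T x₀) x₀ * ‖x‖ ^ 2
      ≤ ‖x‖⁻¹ * (‖x‖⁻¹ * inner ℝ (T x) x) * ‖x‖ ^ 2 :=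
        mul_le_mul_of_nonneg_right h1 (sq_nonneg _)
    _ = inner ℝ (T x) x := by field_simp

end Spectral

/-! ### The nonlinear point perturbation -/

section Main

variable {Y : Finset E3} {Θ : Set (Coord Y × Coord Y)}

lemma exists_pos_le_inner_MOp {γ₀ : ℝ}
    (hγ : IsLeast {μ : ℝ | Module.End.HasEigenvalue (MOp Y 0) μ} γ₀) {lam : ℝ} (hlam : 0 < lam) :
    ∃ ε > 0, ∀ ξ : Coord Y, (γ₀ + ε) * ‖ξ‖ ^ 2 ≤ inner ℝ (MOp Y lam ξ) ξ :=
  exists_pos_mul_norm_sq_le_inner fun ξ hξ =>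
    (mul_norm_sq_le_inner_of_isSymmetric (isSymmetric_MOp 0) (fun _ hμ => hγ.2 hμ) ξ).trans_lt
      (inner_MOp_zero_lt hlam hξ)

lemma hasWeakLaplacian_neg_pointLaplacian (u : pointDomain Y Θ) {u₀ : E3 → ℝ} {ξ : Coord Y}
    (hu : IsDecomp Y u u₀ ξ) :
    HasWeakLaplacian u₀ ((-pointLaplacian Y Θ u : L2) : E3 → ℝ) := by
  obtain ⟨v₀, ζ, hv, hw⟩ := Classical.choose_spec (exists_laplacian_of_mem u)
  obtain ⟨-, rfl⟩ := hu.unique hv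
  rwa [pointLaplacian, neg_neg]

/-- Krein's formula, in implicit form: elements of the domain are recovered from
`f = ((-Δ)_Θ + lam) u` and their coefficients `ξ`, which solve `(Θ + M_lam) ξ ∋ G_lam^* f`. -/
lemma exists_eq_freeResolvent_add (u : pointDomain Y Θ) {lam : ℝ} (hlam : 0 < lam) :
    ∃ ξ : Coord Y,
      (u : L2) = freeResolvent hlam (pointLaplacian Y Θ u + lam • (u : L2)) + G Y hlam ξ ∧
      (ξ, ContinuousLinearMap.adjoint (G Y hlam) (pointLaplacian Y Θ u + lam • (u : L2))
        - MOp Y lam ξ) ∈ Θ := by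
  obtain ⟨u₀, ξ, η, hu, ht, hΘ⟩ := u.2
  have hw := hasWeakLaplacian_neg_pointLaplacian u hu
  rw [show -pointLaplacian Y Θ u
    = lam • (u : L2) - (pointLaplacian Y Θ u + lam • (u : L2)) by abel] at hw
  obtain ⟨h1, h2⟩ := hu.eq_freeResolvent_add hlam ht hw
  exact ⟨ξ, h1, h2 ▸ hΘ⟩

lemma exists_pointDomain_eq {lam : ℝ} (hlam : 0 < lam) (f : L2) {ξ : Coord Y}
    (hξ : (ξ, ContinuousLinearMap.adjoint (G Y hlam) f - MOp Y lam ξ) ∈ Θ) :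
    ∃ u : pointDomain Y Θ, (u : L2) = freeResolvent hlam f + G Y hlam ξ ∧
      pointLaplacian Y Θ u + lam • (u : L2) = f := by
  obtain ⟨u₀, hu, ht, hw⟩ := exists_decomp hlam f ξ
  refine ⟨⟨_, u₀, ξ, _, hu, ht, hξ⟩, rfl, ?_⟩
  have h := (hasWeakLaplacian_neg_pointLaplacian (Θ := Θ) ⟨_, u₀, ξ, _, hu, ht, hξ⟩ hu).unique hw
  rw [← neg_neg (pointLaplacian Y Θ _), h]
  simp

/-- Monotonicity of `(-Δ)_Θ + lam` for every `lam > 0` follows from the resolvent formula, since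
`(-Δ + lam)⁻¹` is positive and `Θ + M_lam` is monotone. Letting `lam` tend to `0` gives the
monotonicity of `(-Δ)_Θ` itself. -/
lemma isMonotoneOp_pointLaplacian {γ₀ : ℝ}
    (hγ : IsLeast {μ : ℝ | Module.End.HasEigenvalue (MOp Y 0) μ} γ₀)
    (hΘ : IsMonotoneRel γ₀ Θ) : IsMonotoneOp 0 (pointLaplacian Y Θ) := by
  intro u v
  simp only [zero_smul, add_zero]
  set a := pointLaplacian Y Θ u - pointLaplacian Y Θ v with ha
  set w := (u : L2) - (v : L2) with hw
  have key : ∀ lam > 0, 0 ≤ inner ℝ a w + lam * ‖w‖ ^ 2 := fun lam hlam => by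
    obtain ⟨ξ, h1, h2⟩ := exists_eq_freeResolvent_add u hlam
    obtain ⟨ζ, h3, h4⟩ := exists_eq_freeResolvent_add v hlam
    obtain ⟨ε, hε, hM⟩ := exists_pos_le_inner_MOp hγ hlam
    set f := pointLaplacian Y Θ u + lam • (u : L2) with hf
    set g := pointLaplacian Y Θ v + lam • (v : L2) with hg
    have hh : f - g = a + lam • w := by
      rw [hf, hg, ha, hw, smul_sub]; abel
    have hw' : w = freeResolvent hlam (f - g) + G Y hlam (ξ - ζ) := by
      rw [freeResolvent_sub, map_sub, hw]
      nth_rewrite 1 [h1, h3]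
      abel
    have e1 : inner ℝ a w + lam * ‖w‖ ^ 2 = inner ℝ (f - g) w := by
      rw [hh, inner_add_left, inner_smul_left, real_inner_self_eq_norm_sq, RCLike.conj_to_real]
    have e2 : inner ℝ (f - g) (G Y hlam (ξ - ζ))
        = inner ℝ (ContinuousLinearMap.adjoint (G Y hlam) (f - g)) (ξ - ζ) :=
      (ContinuousLinearMap.adjoint_inner_left _ _ _).symm
    have e3 : ContinuousLinearMap.adjoint (G Y hlam) (f - g)
        = (ContinuousLinearMap.adjoint (G Y hlam) f - MOp Y lam ξ
          - (ContinuousLinearMap.adjoint (G Y hlam) g - MOp Y lam ζ)) + MOp Y lam (ξ - ζ) := by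
      rw [map_sub, map_sub]; abel
    have h5 := hΘ _ h2 _ h4
    have h6 := hM (ξ - ζ)
    have h7 := mul_norm_sq_freeResolvent_le hlam (f - g)
    have h8 : 0 ≤ lam * ‖freeResolvent hlam (f - g)‖ ^ 2 := by positivity
    have h9 : 0 ≤ ε * ‖ξ - ζ‖ ^ 2 := by positivity
    rw [e1]
    rw [hw', inner_add_right, e2, e3, inner_add_left]
    simp only at h5
    linarith
  refine ge_of_tendsto (x := 𝓝[>] (0 : ℝ)) (f := fun lam => inner ℝ a w + lam * ‖w‖ ^ 2) ?_ ?_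
  · have hc : Continuous fun lam : ℝ => inner ℝ a w + lam * ‖w‖ ^ 2 := by fun_prop
    have := hc.tendsto 0
    rw [zero_mul, add_zero] at this
    exact this.mono_left nhdsWithin_le_nhds
  · filter_upwards [self_mem_nhdsWithin] with lam hlam using key lam hlam

lemma exists_isInverseMap {γ₀ : ℝ}
    (hγ : IsLeast {μ : ℝ | Module.End.HasEigenvalue (MOp Y 0) μ} γ₀)
    (hΘ : IsMaximalMonotoneRel γ₀ Θ) {lam : ℝ} (hlam : 0 < lam) :
    ∃ V : Coord Y → Coord Y, IsInverseMap (relAdd Θ (MOp Y lam)) V := by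
  obtain ⟨ε, hε, hM⟩ := exists_pos_le_inner_MOp hγ hlam
  choose V hV using fun η => hΘ.exists_mem_sub hε hM η
  refine ⟨V, fun ξ η => ⟨fun h => h ▸ hV η, fun h => ?_⟩⟩
  have h1 := hΘ.1 _ (hV η) _ h
  have h2 := hM (V η - ξ)
  have e : η - MOp Y lam (V η) - (η - MOp Y lam ξ) = -MOp Y lam (V η - ξ) := by
    rw [map_sub]; abel
  simp only [e, inner_neg_left] at h1
  have h3 : ‖V η - ξ‖ ^ 2 ≤ 0 := by nlinarith
  exact sub_eq_zero.1 (norm_eq_zero.1 (pow_eq_zero_iff two_ne_zero |>.1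
    (le_antisymm h3 (sq_nonneg _))))

lemma isResolvent_pointLaplacian {lam : ℝ} (hlam : 0 < lam) {V : Coord Y → Coord Y}
    (hV : IsInverseMap (relAdd Θ (MOp Y lam)) V) :
    IsResolvent (pointLaplacian Y Θ) lam fun f =>
      freeResolvent hlam f + G Y hlam (V (ContinuousLinearMap.adjoint (G Y hlam) f)) := by
  refine ⟨fun u => ?_, fun f => ?_⟩
  · obtain ⟨ξ, h1, h2⟩ := exists_eq_freeResolvent_add u hlam
    change freeResolvent hlam _ + G Y hlam (V _) = _
    rw [(hV ξ _).2 h2]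
    exact h1.symm
  · exact exists_pointDomain_eq hlam f ((hV _ _).1 rfl)

end Main

end NLPoint

open NLPoint in
theorem proposition5p1 (Y : Finset E3) (γ₀ : ℝ)
    (hγ : IsLeast {μ : ℝ | Module.End.HasEigenvalue (MOp Y 0) μ} γ₀)
    (Θ : Set (Coord Y × Coord Y)) (hΘ : IsMaximalMonotoneRel γ₀ Θ) :
    -- `(-Δ)_Θ u = -Δ u₀` for every representation `u = u₀ + G₀ ξ` with `u₀ ∈ H̃²(ℝ³)`
    (∀ (u : pointDomain Y Θ) (u₀ : E3 → ℝ) (ξ : Coord Y), IsDecomp Y u u₀ ξ →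
      HasWeakLaplacian u₀ (-pointLaplacian Y Θ u : L2)) ∧
    -- `(-Δ)_Θ` is maximal monotone
    IsMaximalMonotoneOp 0 (pointLaplacian Y Θ) ∧
    -- the resolvent formula
    ∀ (lam : ℝ) (hlam : 0 < lam),
      ∃ (R R₀ : L2 → L2) (V : Coord Y → Coord Y),
        IsResolvent (pointLaplacian Y Θ) lam R ∧
        IsResolvent freeLaplacian lam R₀ ∧
        IsInverseMap (relAdd Θ (MOp Y lam)) V ∧
        ∀ f : L2, R f = R₀ f + G Y hlam (V (ContinuousLinearMap.adjoint (G Y hlam) f)) := by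
  refine ⟨fun u u₀ ξ hu => hasWeakLaplacian_neg_pointLaplacian u hu,
    ⟨isMonotoneOp_pointLaplacian hγ hΘ.1, fun lam hlam => ?_⟩, fun lam hlam => ?_⟩
  · obtain ⟨V, hV⟩ := exists_isInverseMap hγ hΘ hlam
    refine Set.eq_univ_of_forall fun f => ?_
    obtain ⟨u, -, hu⟩ := (isResolvent_pointLaplacian hlam hV).2 f
    exact ⟨u, hu⟩
  · obtain ⟨V, hV⟩ := exists_isInverseMap hγ hΘ hlam
    exact ⟨_, freeResolvent hlam, V, isResolvent_pointLaplacian hlam hV,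
      isResolvent_freeResolvent hlam, hV, fun f => rfl⟩
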